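/- Let $F=\langle a,b,c,d\mid a^2,b^2,c^2,d^2,bcd\rangle$, and for $i\in\{0,1,2\}$ let $i$ also denote the homomorphism $\{1,b,c,d\}\to\{1,a\}$ that is non-trivial with kernel $\langle b\rangle$, $\langle c\rangle$, $\langle d\rangle$ for $i=0,1,2$ respectively. For $\omega=\omega_0\omega_1\omega_2\ldots\in\{0,1,2\}^\infty$ write $\sigma\omega=\omega_1\omega_2\ldots$, and let $\tilde\phi_\omega\colon F\to F\wr\mathrm{Sym}(\{\mathbf 0,\mathbf 1\})=(F\times F)\rtimes\mathrm{Sym}(2)$ be the homomorphism that maps $a$ to the transposition and maps $x$ to $\langle\!\langle\omega_0(x),x\rangle\!\rangle$ for $x\in\{b,c,d\}$. Put $N_{\omega,0}=1$, $N_{\omega,i+1}=\tilde\phi_\omega^{-1}(N_{\sigma\omega,i}\times N_{\sigma\omega,i})$ and $G_\omega=F/\bigcup_i N_{\omega,i}$. The group $G_\omega$ acts on the right on the set $\{\mathbf 0,\mathbf 1\}^\infty$ of left-infinite sequences $\xi=\ldots x_3x_2x_1$ by the rule $(\xi'x)\cdot g=(\xi'\cdot g_x)(x\cdot\pi)$ whenever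 $\tilde\phi_\omega(g)=\langle\!\langle g_{\mathbf 0},g_{\mathbf 1}\rangle\!\rangle\pi$, where $g_x$ acts as an element of $G_{\sigma\omega}$. Let $G_{012}=G_{(012)^\infty}$; it is the first Grigorchuk group. For $\xi\in\{\mathbf 0,\mathbf 1\}^\infty$ and a group $H$, let $X=\xi G_{012}$ be the orbit of $\xi$, and let $$W_{012}(H)=H\wr_X G_{012}=\Big({\prod_X}'H\Big)\rtimes G_{012}$$ be the restricted permutational wreath product, where $\prod_X'H$ is the group of finitely supported functions $X\to H$, with $G_{012}$ acting by $({}^g\!f)(x)=f(xg)$. For a group $W$ generated as a monoid by a finite set $S$ (for example by a finite symmetric set), let $\|g\|_S$ be the least $n$ such that $g$ is a product of $n$ elements of $S$, and let $v_{W,S}(R)=\#\{g\in W:\|g\|_S\le R\}$. For functions $v,w$ of a real variable write $v\precsim w$ if there is a constant $C>0$ such that $v(R)\le w(CR)$ for all sufficiently large $R$, and $v\sim w$ if $v\precsim w\precsim v$. **Theorem.** Let $\eta_+\approx2.46$ be the positive root of $T^3-T^2-2T-4$. For every non-trivial finite group $H$ and every ray $\xi\in\{\mathbf 0,\mathbf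 1\}^\infty$, the group $W_{012}(H)$ is finitely generated, and for every finite set $S$ generating it as a monoid, $$v_{W_{012}(H),S}(R)\sim\exp\big(R^{\log2/\log\eta_+}\big).$$ -/

import Mathlib

namespace GrigorchukWreath

/-! ### Permutations acting on the right, and permutational wreath products -/

/-- The group of permutations of `X`, acting on the right: in the product `σ * τ` one applies
first `σ`, then `τ`. A right action of a group `G` on `X` is a homomorphism `G →* Sym X`. -/
abbrev Sym (X : Type*) : Type _ := (Equiv.Perm X)ᵐᵒᵖ

/-- The image `x · σ` of the point `x` under the permutation `σ`. -/
def Sym.app {X : Type*} (σ : Sym X) (x : X) : X := σ.unop x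

@[simp] theorem Sym.app_one {X : Type*} (x : X) : Sym.app 1 x = x := rfl

@[simp] theorem Sym.app_mul {X : Type*} (σ τ : Sym X) (x : X) :
    Sym.app (σ * τ) x = Sym.app τ (Sym.app σ x) := rfl

@[simp] theorem Sym.app_inv_app {X : Type*} (σ : Sym X) (x : X) :
    Sym.app σ⁻¹ (Sym.app σ x) = x := by
  rw [← Sym.app_mul, mul_inv_cancel, Sym.app_one]

@[simp] theorem Sym.app_app_inv {X : Type*} (σ : Sym X) (x : X) :
    Sym.app σ (Sym.app σ⁻¹ x) = x := by
  rw [← Sym.app_mul, inv_mul_cancel, Sym.app_one]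

/-- The restricted power: functions `X → H` with finite support, under pointwise product. -/
def restrictedPower (X H : Type*) [Group H] : Subgroup (X → H) where
  carrier := {f | (Function.mulSupport f).Finite}
  one_mem' := by simp
  mul_mem' := fun {f g} hf hg =>
    (Set.Finite.union hf hg).subset (Function.mulSupport_mul f g)
  inv_mem' := fun {f} hf => by
    simpa only [Set.mem_ofPred_eq, Function.mulSupport_inv] using hf

/-- Precomposition `(ᵍf)(x) = f (x · g)` of finitely supported functions. -/
def translate {G X : Type*} [Group G] (H : Type*) [Group H] (ρ : G →* Sym X) (g : G)
    (f : restrictedPower X H) : restrictedPower X H :=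
  ⟨fun x => f.1 (Sym.app (ρ g) x), by
    have hf : (Function.mulSupport f.1).Finite := f.2
    exact hf.preimage (Set.injOn_of_injective (ρ g).unop.injective)⟩

/-- The left action of `G` on finitely supported functions, by automorphisms. -/
def translateHom {G X : Type*} [Group G] (H : Type*) [Group H] (ρ : G →* Sym X) :
    G →* MulAut (restrictedPower X H) where
  toFun g :=
    { toFun := translate H ρ g
      invFun := translate H ρ g⁻¹
      left_inv := fun f => by ext x; simp [translate]
      right_inv := fun f => by ext x; simp [translate]
      map_mul' := fun f f' => by ext x; simp [translate] }
  map_one' := by ext f x; simp [translate]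
  map_mul' g g' := by ext f x; simp [translate]

@[simp] theorem translateHom_apply {G X H : Type*} [Group G] [Group H] (ρ : G →* Sym X) (g : G)
    (f : restrictedPower X H) (x : X) : (translateHom H ρ g f).1 x = f.1 (Sym.app (ρ g) x) := rfl

/-- The restricted permutational wreath product `H ≀_X G = (∏'_X H) ⋊ G`, for a right action `ρ`
of `G` on `X`; the product is `(f g) (f' g') = (f · ᵍf') (g g')`. -/
abbrev Wreath {G X : Type*} [Group G] (H : Type*) [Group H] (ρ : G →* Sym X) : Type _ :=
  restrictedPower X H ⋊[translateHom H ρ] G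

theorem Wreath.mul_left_apply {G X H : Type*} [Group G] [Group H] (ρ : G →* Sym X)
    (v w : Wreath H ρ) (x : X) :
    (v * w).left.1 x = v.left.1 x * w.left.1 (Sym.app (ρ v.right) x) := rfl

/-! ### The groups `G_ω` -/

/-- The generators `a, b, c, d`. -/
inductive Letter
  | a | b | c | d
  deriving DecidableEq

/-- The relators `a², b², c², d², bcd`. -/
def relators : Set (FreeGroup Letter) :=
  {FreeGroup.of Letter.a ^ 2, FreeGroup.of Letter.b ^ 2, FreeGroup.of Letter.c ^ 2,
    FreeGroup.of Letter.d ^ 2,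
    FreeGroup.of Letter.b * FreeGroup.of Letter.c * FreeGroup.of Letter.d}

/-- `F = ⟨a, b, c, d | a², b², c², d², bcd⟩`. -/
abbrev F : Type := PresentedGroup relators

/-- A letter as an element of `F`. -/
def gen (x : Letter) : F := PresentedGroup.of x

theorem gen_sq (x : Letter) : gen x * gen x = 1 := by
  have h : FreeGroup.of x ^ 2 ∈ relators := by cases x <;> simp [relators]
  have h' := PresentedGroup.one_of_mem h
  rw [pow_two] at h'
  exact h'

theorem gen_bcd : gen .b * gen .c * gen .d = 1 := by
  have h : FreeGroup.of Letter.b * FreeGroup.of Letter.c * FreeGroup.of Letter.d ∈ relators := by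
    simp [relators]
  exact PresentedGroup.one_of_mem h

/-- The letter among `b, c, d` generating the kernel of the homomorphism
`i : {1, b, c, d} → {1, a}`, for `i = 0, 1, 2` respectively. -/
def kernelLetter : Fin 3 → Letter := ![Letter.b, Letter.c, Letter.d]

/-- The value `i(x) ∈ {1, a} ⊆ F` of the homomorphism `i` at the letter `x ∈ {b, c, d}`
(never used at `x = a`). -/
def homValue (i : Fin 3) (x : Letter) : F := if x = kernelLetter i then 1 else gen .a

/-- An element of `F ≀ Sym(2)`, written `⟨⟨g₀, g₁⟩⟩ π`. -/
def pair (g₀ g₁ : F) (π : Sym (Fin 2)) : Wreath F (MonoidHom.id (Sym (Fin 2))) :=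
  ⟨⟨![g₀, g₁], Set.toFinite _⟩, π⟩

/-- The images of the generators under the wreath recursion with parameter `i = ω₀`: the letter `a`
goes to the transposition, and `x ∈ {b, c, d}` goes to `⟨⟨i(x), x⟩⟩`. -/
def recursionGen (i : Fin 3) : Letter → Wreath F (MonoidHom.id (Sym (Fin 2)))
  | .a => pair 1 1 (MulOpposite.op (Equiv.swap 0 1))
  | .b => pair (homValue i .b) (gen .b) 1
  | .c => pair (homValue i .c) (gen .c) 1
  | .d => pair (homValue i .d) (gen .d) 1

theorem pair_mul (g₀ g₁ h₀ h₁ : F) (π : Sym (Fin 2)) :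
    pair g₀ g₁ 1 * pair h₀ h₁ π = pair (g₀ * h₀) (g₁ * h₁) π := by
  refine SemidirectProduct.ext ?_ (one_mul π)
  ext x
  fin_cases x <;> rfl

theorem pair_one : pair 1 1 1 = 1 := by
  refine SemidirectProduct.ext ?_ rfl
  ext x
  fin_cases x <;> rfl

theorem homValue_sq (i : Fin 3) (x : Letter) : homValue i x * homValue i x = 1 := by
  unfold homValue
  split_ifs
  · simp
  · exact gen_sq _

theorem homValue_bcd (i : Fin 3) : homValue i .b * homValue i .c * homValue i .d = 1 := by
  fin_cases i <;> simp [homValue, kernelLetter, gen_sq]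

theorem recursionGen_relators (i : Fin 3) :
    ∀ r ∈ relators, FreeGroup.lift (recursionGen i) r = 1 := by
  intro r hr
  rcases hr with rfl | rfl | rfl | rfl | rfl
  · simp only [pow_two, map_mul, FreeGroup.lift_apply_of, recursionGen]
    refine SemidirectProduct.ext ?_ ?_
    · have h : ∀ y, (pair 1 1 (MulOpposite.op (Equiv.swap 0 1))).left.1 y = 1 := by
        intro y
        fin_cases y <;> rfl
      ext x
      rw [Wreath.mul_left_apply, h, h, one_mul]
      rfl
    · change MulOpposite.op (Equiv.swap (0 : Fin 2) 1) * MulOpposite.op (Equiv.swap 0 1) = 1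
      rw [← MulOpposite.op_mul, Equiv.swap_mul_self, MulOpposite.op_one]
  · simp only [pow_two, map_mul, FreeGroup.lift_apply_of, recursionGen, pair_mul, homValue_sq,
      gen_sq, pair_one]
  · simp only [pow_two, map_mul, FreeGroup.lift_apply_of, recursionGen, pair_mul, homValue_sq,
      gen_sq, pair_one]
  · simp only [pow_two, map_mul, FreeGroup.lift_apply_of, recursionGen, pair_mul, homValue_sq,
      gen_sq, pair_one]
  · simp only [map_mul, FreeGroup.lift_apply_of, recursionGen, pair_mul, homValue_bcd, gen_bcd,
      pair_one]

/-- The wreath recursion `F → F ≀ Sym(2)` with parameter `i = ω₀`. -/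
def recursion (i : Fin 3) : F →* Wreath F (MonoidHom.id (Sym (Fin 2))) :=
  PresentedGroup.toGroup (recursionGen_relators i)

/-- The sequences `ω ∈ {0, 1, 2}^∞`. -/
abbrev Omega : Type := ℕ → Fin 3

/-- The shift `ω₀ω₁ω₂… ↦ ω₁ω₂…`, on sequences over any alphabet. -/
def shift {A : Type*} (ω : ℕ → A) : ℕ → A := fun n => ω (n + 1)

/-- The subgroup `N²` of the base group of `F ≀ Sym(2)`. -/
def square (N : Subgroup F) : Subgroup (Wreath F (MonoidHom.id (Sym (Fin 2)))) where
  carrier := {w | w.right = 1 ∧ ∀ x, w.left.1 x ∈ N}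
  one_mem' := ⟨rfl, fun _ => N.one_mem⟩
  mul_mem' := fun {v w} hv hw => by
    refine ⟨?_, fun x => ?_⟩
    · rw [SemidirectProduct.mul_right, hv.1, hw.1, one_mul]
    · rw [Wreath.mul_left_apply]
      exact N.mul_mem (hv.2 _) (hw.2 _)
  inv_mem' := fun {v} hv => by
    refine ⟨?_, fun x => ?_⟩
    · rw [SemidirectProduct.inv_right, hv.1, inv_one]
    · have h := Wreath.mul_left_apply _ v⁻¹ v x
      rw [inv_mul_cancel] at h
      rw [eq_inv_of_mul_eq_one_left h.symm]
      exact N.inv_mem (hv.2 _)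

/-- The subgroups `N_{ω,0} = 1` and `N_{ω,i+1} = φ_ω⁻¹ (N_{σω,i} × N_{σω,i})` of `F`. -/
def kernelSeq : ℕ → Omega → Subgroup F
  | 0, _ => ⊥
  | i + 1, ω => (square (kernelSeq i (shift ω))).comap (recursion (ω 0))

theorem mem_kernelSeq_succ (i : ℕ) (ω : Omega) (g : F) :
    g ∈ kernelSeq (i + 1) ω ↔ (recursion (ω 0) g).right = 1 ∧
      ∀ x, (recursion (ω 0) g).left.1 x ∈ kernelSeq i (shift ω) := Iff.rfl

theorem square_normal (N : Subgroup F) (hN : N.Normal) : (square N).Normal := by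
  refine ⟨fun v hv w => ⟨?_, fun x => ?_⟩⟩
  · simp only [SemidirectProduct.mul_right, SemidirectProduct.inv_right, hv.1, mul_one,
      mul_inv_cancel]
  · have h := Wreath.mul_left_apply _ (w * v * w⁻¹) w x
    rw [inv_mul_cancel_right, Wreath.mul_left_apply] at h
    have h2 : (w * v * w⁻¹).right = 1 := by
      simp only [SemidirectProduct.mul_right, SemidirectProduct.inv_right, hv.1, mul_one,
        mul_inv_cancel]
    rw [h2, map_one, Sym.app_one] at h
    rw [← mul_inv_eq_iff_eq_mul.2 h]
    exact hN.conj_mem _ (hv.2 _) _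

theorem kernelSeq_normal (i : ℕ) : ∀ ω : Omega, (kernelSeq i ω).Normal := by
  induction i with
  | zero => intro ω; exact Subgroup.normal_bot
  | succ i ih => intro ω; exact (square_normal _ (ih _)).comap _

theorem kernelSeq_le_succ (i : ℕ) : ∀ ω : Omega, kernelSeq i ω ≤ kernelSeq (i + 1) ω := by
  induction i with
  | zero => intro ω; exact bot_le
  | succ i ih =>
    intro ω g hg
    rw [mem_kernelSeq_succ] at hg ⊢
    exact ⟨hg.1, fun x => ih _ (hg.2 x)⟩

/-- The union `⋃ᵢ N_{ω,i}`. -/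
def kernel (ω : Omega) : Subgroup F := ⨆ i, kernelSeq i ω

theorem mem_kernel (ω : Omega) (g : F) : g ∈ kernel ω ↔ ∃ i, g ∈ kernelSeq i ω :=
  Subgroup.mem_iSup_of_directed
    (monotone_nat_of_le_succ fun i => kernelSeq_le_succ i ω).directed_le

instance kernel_normal (ω : Omega) : (kernel ω).Normal := by
  refine ⟨fun g hg h => ?_⟩
  rw [mem_kernel] at hg ⊢
  obtain ⟨i, hi⟩ := hg
  exact ⟨i, (kernelSeq_normal i ω).conj_mem g hi h⟩

/-- The group `G_ω = F / ⋃ᵢ N_{ω,i}`. -/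
abbrev G (ω : Omega) : Type := F ⧸ kernel ω

/-! ### The right action on rays -/

/-- Rays of the binary rooted tree. The left-infinite sequence `… x₃ x₂ x₁` is the function
`n ↦ x_{n+1}`. -/
abbrev Ray : Type := ℕ → Fin 2

/-- The digit of index `n` of `ξ · g`, for `g ∈ F` acting through the iterated wreath recursion:
if `g` maps to `⟨⟨g₀, g₁⟩⟩ π` then `(ξ' x) · g = (ξ' · g_x) (x · π)`. -/
def digit : ℕ → Omega → F → Ray → Fin 2
  | 0, ω, g, ξ => Sym.app (recursion (ω 0) g).right (ξ 0)
  | n + 1, ω, g, ξ => digit n (shift ω) ((recursion (ω 0) g).left.1 (ξ 0)) (shift ξ)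

/-- The ray `ξ · g`. -/
def move (ω : Omega) (g : F) (ξ : Ray) : Ray := fun n => digit n ω g ξ

theorem shift_move (ω : Omega) (g : F) (ξ : Ray) :
    shift (move ω g ξ) = move (shift ω) ((recursion (ω 0) g).left.1 (ξ 0)) (shift ξ) := rfl

theorem digit_mul (n : ℕ) : ∀ (ω : Omega) (g h : F) (ξ : Ray),
    digit n ω (g * h) ξ = digit n ω h (move ω g ξ) := by
  induction n with
  | zero => intro ω g h ξ; simp [digit, move]
  | succ n ih =>
    intro ω g h ξ
    simp only [digit, map_mul, Wreath.mul_left_apply, ih, shift_move]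
    rfl

theorem digit_of_mem (n : ℕ) : ∀ (i : ℕ) (ω : Omega) (g : F) (ξ : Ray), g ∈ kernelSeq i ω →
    digit n ω g ξ = ξ n := by
  induction n with
  | zero =>
    intro i ω g ξ hg
    rw [digit, (kernelSeq_le_succ i ω hg).1, Sym.app_one]
  | succ n ih =>
    intro i ω g ξ hg
    rw [digit, ih i _ _ _ ((kernelSeq_le_succ i ω hg).2 _)]
    rfl

theorem move_mul (ω : Omega) (g h : F) (ξ : Ray) :
    move ω (g * h) ξ = move ω h (move ω g ξ) := funext fun n => digit_mul n ω g h ξ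

theorem move_of_mem (ω : Omega) (g : F) (hg : g ∈ kernel ω) (ξ : Ray) : move ω g ξ = ξ := by
  obtain ⟨i, hi⟩ := (mem_kernel ω g).1 hg
  exact funext fun n => digit_of_mem n i ω g ξ hi

theorem move_one (ω : Omega) (ξ : Ray) : move ω 1 ξ = ξ :=
  move_of_mem ω 1 (one_mem _) ξ

/-- The right action of `F` on rays determined by `ω`. -/
def rayHomF (ω : Omega) : F →* Sym Ray where
  toFun g := MulOpposite.op
    { toFun := move ω g
      invFun := move ω g⁻¹
      left_inv := fun ξ => by rw [← move_mul, mul_inv_cancel, move_one]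
      right_inv := fun ξ => by rw [← move_mul, inv_mul_cancel, move_one] }
  map_one' := MulOpposite.unop_injective (Equiv.ext fun ξ => move_one ω ξ)
  map_mul' g h := MulOpposite.unop_injective (Equiv.ext fun ξ => move_mul ω g h ξ)

/-- The right action of `G_ω` on rays. -/
def rayHom (ω : Omega) : G ω →* Sym Ray :=
  QuotientGroup.lift (kernel ω) (rayHomF ω) fun g hg =>
    MulOpposite.unop_injective (Equiv.ext fun ξ => move_of_mem ω g hg ξ)

/-- The orbit `X = ξ G_ω`. -/
def Orbit (ω : Omega) (ξ : Ray) : Type := {ζ : Ray // ∃ g : G ω, Sym.app (rayHom ω g) ξ = ζ}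

theorem orbit_invariant (ω : Omega) (ξ : Ray) (g : G ω) (ζ : Ray) :
    (∃ h : G ω, Sym.app (rayHom ω h) ξ = (rayHom ω g).unop ζ) ↔
      ∃ h : G ω, Sym.app (rayHom ω h) ξ = ζ := by
  constructor
  · rintro ⟨h, hh⟩
    refine ⟨h * g⁻¹, ?_⟩
    rw [map_mul, Sym.app_mul, hh, map_inv]
    exact Sym.app_inv_app _ _
  · rintro ⟨h, rfl⟩
    exact ⟨h * g, by rw [map_mul, Sym.app_mul]; rfl⟩

/-- The right action of `G_ω` on the orbit `ξ G_ω`. -/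
def orbitHom (ω : Omega) (ξ : Ray) : G ω →* Sym (Orbit ω ξ) where
  toFun g := MulOpposite.op ((rayHom ω g).unop.subtypePerm (orbit_invariant ω ξ g))
  map_one' := MulOpposite.unop_injective <| Equiv.ext fun ζ => Subtype.ext <| by
    change (rayHom ω 1).unop ζ.1 = ζ.1
    rw [map_one]; rfl
  map_mul' g h := MulOpposite.unop_injective <| Equiv.ext fun ζ => Subtype.ext <| by
    change (rayHom ω (g * h)).unop ζ.1 = (rayHom ω h).unop ((rayHom ω g).unop ζ.1)
    rw [map_mul]; rfl

/-- `W_ω(H) = H ≀_X G_ω`, where `X = ξ G_ω`. -/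
abbrev W (ω : Omega) (ξ : Ray) (H : Type*) [Group H] : Type _ := Wreath H (orbitHom ω ξ)

/-- The periodic sequence `(012)^∞ = 012012…`. -/
def omega012 : Omega := fun n => Fin.ofNat 3 n

/-! ### Growth -/

/-- The word norm of `g` with respect to `S`, a set generating the group as a monoid (for instance a
symmetric generating set): the least `n` such that `g` is a product of `n` elements of `S`. -/
noncomputable def wordNorm {Γ : Type*} [Group Γ] (S : Set Γ) (g : Γ) : ℕ :=
  sInf {n | ∃ l : List Γ, l.length = n ∧ (∀ s ∈ l, s ∈ S) ∧ l.prod = g}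

/-- The growth function `v_{Γ,S}(R) = #{g ∈ Γ : ‖g‖ ≤ R}`. -/
noncomputable def growth {Γ : Type*} [Group Γ] (S : Set Γ) (R : ℝ) : ℝ :=
  ({g : Γ | (wordNorm S g : ℝ) ≤ R}.ncard : ℝ)

/-- `v ≾ w`: there is a constant `C > 0` with `v(R) ≤ w(C R)` for all large enough `R`. -/
def Dominated (v w : ℝ → ℝ) : Prop :=
  ∃ C : ℝ, 0 < C ∧ ∀ᶠ R in Filter.atTop, v R ≤ w (C * R)

/-- Equivalence of growth functions. -/
def GrowthEquiv (v w : ℝ → ℝ) : Prop := Dominated v w ∧ Dominated w v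

theorem existsUnique_root : ∃! η : ℝ, 0 < η ∧ η ^ 3 - η ^ 2 - 2 * η - 4 = 0 := by
  have hc : ContinuousOn (fun x : ℝ => x ^ 3 - x ^ 2 - 2 * x - 4) (Set.Icc 2 3) := by fun_prop
  obtain ⟨x, hx, hx0⟩ := intermediate_value_Icc (by norm_num : (2 : ℝ) ≤ 3) hc
    (show (0 : ℝ) ∈ Set.Icc _ _ by norm_num)
  refine ⟨x, ⟨by linarith [hx.1], hx0⟩, ?_⟩
  rintro y ⟨hy, hy0⟩
  have hx0 : x ^ 3 - x ^ 2 - 2 * x - 4 = 0 := hx0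
  have hxp : 0 < x := by linarith [hx.1]
  by_contra hne
  have h1 : 0 < x ^ 2 - x - 2 := by
    by_contra h; nlinarith
  have h2 : 0 < y ^ 2 - y - 2 := by
    by_contra h; nlinarith
  have h3 : (y - x) * (x ^ 2 + x * y + y ^ 2 - x - y - 2) = 0 := by linear_combination hy0 - hx0
  rcases mul_eq_zero.1 h3 with h | h
  · exact hne (by linarith)
  · nlinarith [mul_pos hxp hy]

/-- The unique positive root `η₊` of `T³ - T² - 2T - 4`. -/
noncomputable def etaPlus : ℝ := Classical.choose existsUnique_root.exists

theorem etaPlus_spec : 0 < etaPlus ∧ etaPlus ^ 3 - etaPlus ^ 2 - 2 * etaPlus - 4 = 0 :=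
  Classical.choose_spec existsUnique_root.exists

end GrigorchukWreath

namespace GrigorchukWreath

/-! ### Letters and sections -/

/-- The letters `b, c, d`, numbered relatively to the kernel letter of `i`. -/
def letter (i t : Fin 3) : F := gen (kernelLetter (i + t))

/-- The elements of `{1, b, c, d}`, numbered relatively to the kernel letter of `i`. -/
def vgen (i : Fin 3) : Option (Fin 3) → F
  | none => 1
  | some t => letter i t

theorem gen_eq_inv (x : Letter) : (gen x)⁻¹ = gen x := inv_eq_of_mul_eq_one_left (gen_sq x)

theorem gen_bc : gen .b * gen .c = gen .d := by
  rw [eq_comm, ← gen_eq_inv, eq_comm]; exact eq_inv_of_mul_eq_one_left gen_bcd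

theorem kernelLetter_mul (s t : Fin 3) (h : s ≠ t) :
    gen (kernelLetter s) * gen (kernelLetter t) = gen (kernelLetter (-(s + t))) := by
  have hbc := gen_bc
  have hcb : gen .c * gen .b = gen .d := by
    rw [← gen_eq_inv .d, ← hbc, mul_inv_rev, gen_eq_inv, gen_eq_inv]
  have hbd : gen .b * gen .d = gen .c := by rw [← hbc, ← mul_assoc, gen_sq, one_mul]
  have hdc : gen .d * gen .c = gen .b := by rw [← hbc, mul_assoc, gen_sq, mul_one]
  have hcd : gen .c * gen .d = gen .b := by rw [← hcb, ← mul_assoc, gen_sq, one_mul]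
  have hdb : gen .d * gen .b = gen .c := by rw [← hcb, mul_assoc, gen_sq, mul_one]
  fin_cases s <;> fin_cases t <;> first | exact absurd rfl h | assumption

theorem letter_sq (i t : Fin 3) : letter i t * letter i t = 1 := gen_sq _

theorem letter_mul (i t u : Fin 3) (h : t ≠ u) :
    letter i t * letter i u = letter i (-(t + u)) := by
  unfold letter
  rw [kernelLetter_mul _ _ (by simpa using h)]
  congr 2
  revert i t u; decide

/-- The transposition. -/
def flip : Sym (Fin 2) := MulOpposite.op (Equiv.swap 0 1)

@[simp] theorem flip_zero : Sym.app flip 0 = 1 := rfl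
@[simp] theorem flip_one : Sym.app flip 1 = 0 := rfl
/-- The section of `g` at the digit `y`. -/
def sec (i : Fin 3) (g : F) (y : Fin 2) : F := (recursion i g).left.1 y

/-- The action of `g` on the first digit. -/
def perm (i : Fin 3) : F →* Sym (Fin 2) := SemidirectProduct.rightHom.comp (recursion i)

@[simp] theorem sec_one (i : Fin 3) (y : Fin 2) : sec i 1 y = 1 := by
  simp [sec]

@[simp] theorem sec_mul (i : Fin 3) (g h : F) (y : Fin 2) :
    sec i (g * h) y = sec i g y * sec i h (Sym.app (perm i g) y) := by
  simp only [sec, map_mul, Wreath.mul_left_apply]; rfl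

theorem recursion_gen (i : Fin 3) (x : Letter) : recursion i (gen x) = recursionGen i x :=
  PresentedGroup.toGroup.of _

@[simp] theorem sec_a (i : Fin 3) (y : Fin 2) : sec i (gen .a) y = 1 := by
  rw [sec, recursion_gen]; fin_cases y <;> rfl

@[simp] theorem perm_a (i : Fin 3) : perm i (gen .a) = flip := by
  change (recursion i (gen .a)).right = _
  rw [recursion_gen]; rfl

theorem recursion_letter (i t : Fin 3) :
    recursion i (letter i t) = pair (if t = 0 then 1 else gen .a) (letter (i + 1) (t - 1)) 1 := by
  rw [letter, recursion_gen, letter, show i + 1 + (t - 1) = i + t by revert i t; decide]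
  fin_cases i <;> fin_cases t <;> simp [recursionGen, homValue, kernelLetter]

@[simp] theorem perm_letter (i t : Fin 3) : perm i (letter i t) = 1 := by
  change (recursion i (letter i t)).right = _
  rw [recursion_letter]; rfl

@[simp] theorem sec_letter_zero (i t : Fin 3) :
    sec i (letter i t) 0 = if t = 0 then 1 else gen .a := by
  rw [sec, recursion_letter]; rfl

@[simp] theorem sec_letter_one (i t : Fin 3) :
    sec i (letter i t) 1 = letter (i + 1) (t - 1) := by
  rw [sec, recursion_letter]; rfl

@[simp] theorem perm_vgen (i : Fin 3) (x : Option (Fin 3)) : perm i (vgen i x) = 1 := by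
  cases x <;> simp [vgen]

/-! ### Rays -/

/-- The ray `ζ y`. -/
def snoc (y : Fin 2) (ζ : Ray) : Ray
  | 0 => y
  | n + 1 => ζ n

@[simp] theorem shift_snoc (y : Fin 2) (ζ : Ray) : shift (snoc y ζ) = ζ := rfl

@[simp] theorem snoc_shift (ξ : Ray) : snoc (ξ 0) (shift ξ) = ξ := by
  funext n; cases n <;> rfl

theorem snoc_inj {y z : Fin 2} {ζ θ : Ray} : snoc y ζ = snoc z θ ↔ y = z ∧ ζ = θ := by
  refine ⟨fun h => ⟨congrFun h 0, ?_⟩, by rintro ⟨rfl, rfl⟩; rfl⟩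
  rw [← shift_snoc y ζ, h, shift_snoc]

theorem snoc_injective (y : Fin 2) : Function.Injective (snoc y) :=
  fun _ _ h => (snoc_inj.1 h).2

theorem move_snoc (ω : Omega) (g : F) (y : Fin 2) (ζ : Ray) :
    move ω g (snoc y ζ) =
      snoc (Sym.app (perm (ω 0) g) y) (move (shift ω) (sec (ω 0) g y) ζ) := by
  funext n; cases n <;> rfl

theorem move_injective (ω : Omega) (g : F) : Function.Injective (move ω g) := fun ζ θ h => by
  rw [← move_one ω ζ, ← move_one ω θ, ← mul_inv_cancel g, move_mul, h, move_mul]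

/-- Sequences like `012012…`, in which each term is followed by its cyclic successor. -/
def IsCyclic (ω : Omega) : Prop := ∀ n, ω (n + 1) = ω n + 1

theorem IsCyclic.shift {ω : Omega} (h : IsCyclic ω) : IsCyclic (shift ω) := fun n => h (n + 1)

theorem IsCyclic.shift_zero {ω : Omega} (h : IsCyclic ω) : GrigorchukWreath.shift ω 0 = ω 0 + 1 :=
  h 0

theorem isCyclic_omega012 : IsCyclic omega012 := fun n => by
  apply Fin.ext
  simp [omega012, Fin.ofNat, Fin.val_add]

/-! ### The contraction ratio and the weights of the letters -/

/-- The contraction ratio `2 / η₊`. -/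
noncomputable def ratio : ℝ := 2 / etaPlus

theorem etaPlus_gt_two : 2 < etaPlus := by
  obtain ⟨h0, h⟩ := etaPlus_spec
  by_contra! hle
  nlinarith [mul_nonneg h0.le (sub_nonneg.2 hle), mul_nonneg (sq_nonneg etaPlus) (sub_nonneg.2 hle)]

theorem etaPlus_pos : 0 < etaPlus := etaPlus_spec.1

theorem ratio_pos : 0 < ratio := div_pos two_pos etaPlus_pos

theorem ratio_lt_one : ratio < 1 := (div_lt_one etaPlus_pos).2 etaPlus_gt_two

theorem ratio_mul_etaPlus : ratio * etaPlus = 2 := div_mul_cancel₀ _ etaPlus_pos.ne'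

theorem ratio_spec : ratio ^ 3 + ratio ^ 2 + ratio = 2 := by
  have h := etaPlus_spec.2
  have h0 := etaPlus_pos
  unfold ratio
  field_simp
  linarith

/-- The weight of the letter `a`. -/
noncomputable def wtA : ℝ := 1 - ratio ^ 3

/-- The weights of the elements of `{1, b, c, d}`. -/
noncomputable def wt : Option (Fin 3) → ℝ
  | none => 0
  | some t => ![1 - ratio, 1 - ratio ^ 2, ratio ^ 3] t

theorem wtA_pos : 0 < wtA := sub_pos.2 (pow_lt_one₀ ratio_pos.le ratio_lt_one (by norm_num))

theorem wt_nonneg (x : Option (Fin 3)) : 0 ≤ wt x := by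
  have h0 := ratio_pos.le
  have h1 := ratio_lt_one
  have h2 : ratio ^ 2 ≤ 1 := pow_le_one₀ h0 h1.le
  have h3 : 0 ≤ ratio ^ 3 := by positivity
  rcases x with _ | t
  · exact le_rfl
  · fin_cases t <;> simp only [wt] <;> change (0 : ℝ) ≤ _ <;>
      [change _ ≤ 1 - ratio; change _ ≤ 1 - ratio ^ 2; change _ ≤ ratio ^ 3] <;> linarith

theorem vgen_mul (i : Fin 3) (x y : Option (Fin 3)) :
    ∃ z, vgen i x * vgen i y = vgen i z ∧ wt z ≤ wt x + wt y := by
  rcases x with _ | t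
  · exact ⟨y, one_mul _, by simp [wt]⟩
  rcases y with _ | u
  · exact ⟨some t, mul_one _, by simp [wt]⟩
  by_cases h : t = u
  · exact ⟨none, h ▸ letter_sq i t, add_nonneg (wt_nonneg _) (wt_nonneg _)⟩
  · refine ⟨some (-(t + u)), letter_mul i t u h, ?_⟩
    have h0 := ratio_pos.le
    have h1 := ratio_lt_one
    have h2 : ratio ^ 2 ≤ ratio := by nlinarith
    have h3 : ratio ^ 3 ≤ ratio ^ 2 := by nlinarith [sq_nonneg ratio]
    have h4 := ratio_spec
    fin_cases t <;> fin_cases u <;> simp [wt] at h ⊢ <;> linarith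

/-! ### The substitution and inverted orbits -/

/-- The word `a x₁ a x₂ … a xₙ` as an element of `F`. -/
def val (i : Fin 3) (l : List (Fin 3)) : F := (l.map fun t => gen .a * letter i t).prod

@[simp] theorem val_nil (i : Fin 3) : val i [] = 1 := rfl

@[simp] theorem val_cons (i t : Fin 3) (l : List (Fin 3)) :
    val i (t :: l) = gen .a * (letter i t * val i l) := by
  simp [val, mul_assoc]

/-- The substitution on letters: `ab ↦ abadac`, `ac ↦ abab`, `ad ↦ acac` in the relative
numbering `0 = d`, `1 = c`, `2 = b`. -/
def zetaLetter : Fin 3 → List (Fin 3) := ![[1, 1], [2, 2], [2, 0, 1]]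

/-- The substitution on words. -/
def zeta (l : List (Fin 3)) : List (Fin 3) := l.flatMap zetaLetter

theorem zeta_cons (t : Fin 3) (l : List (Fin 3)) : zeta (t :: l) = zetaLetter t ++ zeta l := rfl

theorem zeta_append (l m : List (Fin 3)) : zeta (l ++ m) = zeta l ++ zeta m :=
  List.flatMap_append

@[simp] theorem a_mul_a_mul (g : F) : gen .a * (gen .a * g) = g := by
  rw [← mul_assoc, gen_sq, one_mul]

@[simp] theorem letter_mul_letter_mul (i t : Fin 3) (g : F) :
    letter i t * (letter i t * g) = g := by
  rw [← mul_assoc, letter_sq, one_mul]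

theorem letter_one_zero_mul (i : Fin 3) (g : F) :
    letter i 1 * (letter i 0 * g) = letter i 2 * g := by
  rw [← mul_assoc, letter_mul i 1 0 (by decide)]; rfl

/-- The sections of the image of a word under the substitution are conjugate to the word. -/
theorem recursion_val_zeta (i : Fin 3) (l : List (Fin 3)) :
    (perm i (val i (zeta l)) = 1 ∧
      sec i (val i (zeta l)) 0 = gen .a * val (i + 1) l * gen .a ∧
      sec i (val i (zeta l)) 1 = val (i + 1) l) ∨
    (perm i (val i (zeta l)) = flip ∧
      sec i (val i (zeta l)) 0 = gen .a * val (i + 1) l ∧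
      sec i (val i (zeta l)) 1 = val (i + 1) l * gen .a) := by
  have hf : flip * flip = 1 := MulOpposite.unop_injective (Equiv.swap_mul_self 0 1)
  have h02 : (0 : Fin 3) - 1 = 2 := rfl
  have h20 : (2 : Fin 3) - 1 = 1 := rfl
  induction l with
  | nil => left; simp [zeta, gen_sq]
  | cons t l ih =>
    rw [zeta_cons]
    rcases ih with ⟨hp, h0, h1⟩ | ⟨hp, h0, h1⟩ <;> fin_cases t <;>
      simp [zetaLetter, hp, h0, h1, hf, h02, h20, mul_assoc, letter_one_zero_mul]

/-- The points `ξ · s`, for non-empty proper suffixes `s` of the word `l`. -/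
def suffixPoints (ω : Omega) (l : List (Fin 3)) (ξ : Ray) : Set Ray :=
  {ζ | ∃ s, s ≠ [] ∧ s ≠ l ∧ s <:+ l ∧ move ω (val (ω 0) s) ξ = ζ}

theorem suffixPoints_finite (ω : Omega) (l : List (Fin 3)) (ξ : Ray) :
    (suffixPoints ω l ξ).Finite := by
  refine ((l.tails.toFinset.finite_toSet).image fun s => move ω (val (ω 0) s) ξ).subset ?_
  rintro _ ⟨s, -, -, hs, rfl⟩
  exact ⟨s, by simpa using hs, rfl⟩

theorem suffix_zeta {s l r : List (Fin 3)} {t : Fin 3} (h : t :: s <:+ l)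
    (hr : r <:+ zetaLetter t) (hr' : r ≠ zetaLetter t) (hne : r ++ zeta s ≠ []) :
    r ++ zeta s ≠ [] ∧ r ++ zeta s ≠ zeta l ∧ r ++ zeta s <:+ zeta l := by
  obtain ⟨p, rfl⟩ := h
  obtain ⟨q, hq⟩ := hr
  refine ⟨hne, fun h => ?_, ⟨zeta p ++ q, ?_⟩⟩
  · have h1 := congrArg List.length h
    have h2 := congrArg List.length hq
    rw [zeta_append, zeta_cons, ← hq] at h1
    simp only [List.length_append] at h1
    have : q = [] := List.eq_nil_of_length_eq_zero (by omega)
    subst this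
    exact hr' hq
  · rw [zeta_append, zeta_cons, ← hq]; simp

theorem zeta_ne_nil {l : List (Fin 3)} (h : l ≠ []) : zeta l ≠ [] := by
  cases l with
  | nil => exact absurd rfl h
  | cons t l => rw [zeta_cons]; fin_cases t <;> simp [zetaLetter]

set_option linter.unusedSimpArgs false in
theorem snoc_mem_suffixPoints_zeta {ω : Omega} (hω : IsCyclic ω) {l s : List (Fin 3)}
    (hs : s ≠ []) (hsl : s ≠ l) (h : s <:+ l) (y : Fin 2) (ξ : Ray) :
    snoc 1 (move (shift ω) ((if y = 1 then 1 else gen .a) * val (shift ω 0) s) ξ) ∈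
        suffixPoints ω (zeta l) (snoc y ξ) ∧
      snoc 0 (move (shift ω) ((if y = 1 then 1 else gen .a) * (val (shift ω 0) s * gen .a)) ξ) ∈
        suffixPoints ω (zeta l) (snoc y ξ) := by
  have hf : flip * flip = 1 := MulOpposite.unop_injective (Equiv.swap_mul_self 0 1)
  have h02 : (0 : Fin 3) - 1 = 2 := rfl
  have h20 : (2 : Fin 3) - 1 = 1 := rfl
  rw [hω.shift_zero]
  obtain ⟨t', ht'⟩ : ∃ t', t' :: s <:+ l := by
    obtain ⟨p, rfl⟩ := h
    rcases List.eq_nil_or_concat p with rfl | ⟨p, t', rfl⟩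
    · exact absurd rfl hsl
    · exact ⟨t', p, by simp⟩
  obtain ⟨m, hm0, hm⟩ : ∃ m : Fin 3, m ≠ 0 ∧ [m] <:+ zetaLetter t' ∧ [m] ≠ zetaLetter t' := by
    clear ht'; revert t'; decide
  have hpt : ∀ g, ∀ q : List (Fin 3), (q ≠ [] ∧ q ≠ zeta l ∧ q <:+ zeta l) →
      move ω (val (ω 0) q) (snoc y ξ) = g → g ∈ suffixPoints ω (zeta l) (snoc y ξ) :=
    fun g q hq hg => ⟨q, hq.1, hq.2.1, hq.2.2, hg⟩
  have hs1 := suffix_zeta (r := []) ht' List.nil_suffix (by fin_cases t' <;> simp [zetaLetter])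
    (zeta_ne_nil hs)
  have hs2 := suffix_zeta ht' hm.1 hm.2 (by simp)
  obtain rfl | rfl : y = 1 ∨ y = 0 := by omega
  · rcases recursion_val_zeta (ω 0) s with ⟨hp, h0, h1⟩ | ⟨hp, h0, h1⟩
    · exact ⟨hpt _ _ hs1 (by simp [move_snoc, hp, h1]),
        hpt _ _ hs2 (by simp [move_snoc, hp, h0, hm0, mul_assoc])⟩
    · exact ⟨hpt _ _ hs2 (by simp [move_snoc, hp, h0, hm0, mul_assoc]),
        hpt _ _ hs1 (by simp [move_snoc, hp, h1])⟩
  · cases s with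
    | nil => exact absurd rfl hs
    | cons t s =>
      have hs3 : ∀ r, r ≠ [] → r <:+ zetaLetter t → r ≠ zetaLetter t → _ := fun r hr h1 h2 =>
        suffix_zeta h h1 h2 (by simp [hr])
      rcases recursion_val_zeta (ω 0) s with ⟨hp, h0, h1⟩ | ⟨hp, h0, h1⟩ <;> fin_cases t
      · exact ⟨hpt _ _ (hs3 [1] (by decide) (by decide) (by decide)) (by simp [zeta_cons, zetaLetter, move_snoc, hp, h0, h1, hf, h02, h20, mul_assoc,
          letter_one_zero_mul]),
          hpt _ _ hs1 (by simp [zeta_cons, zetaLetter, move_snoc, hp, h0, h1, hf, h02, h20, mul_assoc,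
          letter_one_zero_mul])⟩
      · exact ⟨hpt _ _ (hs3 [2] (by decide) (by decide) (by decide)) (by simp [zeta_cons, zetaLetter, move_snoc, hp, h0, h1, hf, h02, h20, mul_assoc,
          letter_one_zero_mul]),
          hpt _ _ hs1 (by simp [zeta_cons, zetaLetter, move_snoc, hp, h0, h1, hf, h02, h20, mul_assoc,
          letter_one_zero_mul])⟩
      · exact ⟨hpt _ _ hs1 (by simp [zeta_cons, zetaLetter, move_snoc, hp, h0, h1, hf, h02, h20, mul_assoc,
          letter_one_zero_mul]),
          hpt _ _ (hs3 [0, 1] (by decide) (by decide) (by decide)) (by simp [zeta_cons, zetaLetter, move_snoc, hp, h0, h1, hf, h02, h20, mul_assoc,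
          letter_one_zero_mul])⟩
      · exact ⟨hpt _ _ hs1 (by simp [zeta_cons, zetaLetter, move_snoc, hp, h0, h1, hf, h02, h20, mul_assoc,
          letter_one_zero_mul]),
          hpt _ _ (hs3 [1] (by decide) (by decide) (by decide)) (by simp [zeta_cons, zetaLetter, move_snoc, hp, h0, h1, hf, h02, h20, mul_assoc,
          letter_one_zero_mul])⟩
      · exact ⟨hpt _ _ hs1 (by simp [zeta_cons, zetaLetter, move_snoc, hp, h0, h1, hf, h02, h20, mul_assoc,
          letter_one_zero_mul]),
          hpt _ _ (hs3 [2] (by decide) (by decide) (by decide)) (by simp [zeta_cons, zetaLetter, move_snoc, hp, h0, h1, hf, h02, h20, mul_assoc,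
          letter_one_zero_mul])⟩
      · exact ⟨hpt _ _ (hs3 [0, 1] (by decide) (by decide) (by decide)) (by simp [zeta_cons, zetaLetter, move_snoc, hp, h0, h1, hf, h02, h20, mul_assoc,
          letter_one_zero_mul]),
          hpt _ _ hs1 (by simp [zeta_cons, zetaLetter, move_snoc, hp, h0, h1, hf, h02, h20, mul_assoc,
          letter_one_zero_mul])⟩

theorem ncard_suffixPoints_zeta {ω : Omega} (hω : IsCyclic ω) (l : List (Fin 3)) (n : ℕ)
    (h : ∀ ξ, n ≤ (suffixPoints (shift ω) l ξ).ncard) (ξ : Ray) :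
    2 * n ≤ (suffixPoints ω (zeta l) ξ).ncard := by
  rw [← snoc_shift ξ]
  generalize ξ 0 = y, shift ξ = ξ
  have key := h (move (shift ω) (if y = 1 then 1 else gen .a) ξ)
  set D := suffixPoints (shift ω) l (move (shift ω) (if y = 1 then 1 else gen .a) ξ)
  have hD : D.Finite := suffixPoints_finite _ _ _
  have h1 : snoc 1 '' D ∪ (fun ζ => snoc 0 (move (shift ω) (gen .a) ζ)) '' D ⊆
      suffixPoints ω (zeta l) (snoc y ξ) := by
    rintro _ (⟨_, ⟨s, h1, h2, h3, rfl⟩, rfl⟩ | ⟨_, ⟨s, h1, h2, h3, rfl⟩, rfl⟩)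
    · rw [← move_mul]
      exact (snoc_mem_suffixPoints_zeta hω h1 h2 h3 y ξ).1
    · simp only [← move_mul, mul_assoc]
      exact (snoc_mem_suffixPoints_zeta hω h1 h2 h3 y ξ).2
  refine le_trans ?_ (Set.ncard_le_ncard h1 (suffixPoints_finite _ _ _))
  rw [Set.ncard_union_eq _ (hD.image _) (hD.image _),
    Set.ncard_image_of_injective _ (snoc_injective 1),
    Set.ncard_image_of_injective _ fun a b hab => move_injective _ _ (snoc_injective 0 hab)]
  · omega
  · rw [Set.disjoint_left]
    rintro _ ⟨a, -, rfl⟩ ⟨b, -, hb⟩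
    exact absurd (snoc_inj.1 hb).1 (by decide)

/-- The iterated images of a short word under the substitution. -/
def zetaIter (k : ℕ) : List (Fin 3) := zeta^[k] [2, 2]

theorem two_pow_le_ncard_suffixPoints (k : ℕ) : ∀ {ω : Omega}, IsCyclic ω → ∀ ξ : Ray,
    2 ^ k ≤ (suffixPoints ω (zetaIter k) ξ).ncard := by
  induction k with
  | zero =>
    intro ω _ ξ
    rw [pow_zero, Nat.one_le_iff_ne_zero, Ne, Set.ncard_eq_zero (suffixPoints_finite _ _ _),
      ← Ne, ← Set.nonempty_iff_ne_empty]
    exact ⟨_, [2], by decide, by decide, by decide, rfl⟩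
  | succ k ih =>
    intro ω hω ξ
    rw [zetaIter, Function.iterate_succ_apply', pow_succ']
    exact ncard_suffixPoints_zeta hω _ _ (ih hω.shift) ξ

/-- A weighted length that the substitution multiplies by `η₊`. -/
noncomputable def zetaWeight (l : List (Fin 3)) : ℝ :=
  (l.map ![ratio ^ 2, ratio, 1]).sum

theorem zetaWeight_append (l m : List (Fin 3)) :
    zetaWeight (l ++ m) = zetaWeight l + zetaWeight m := by
  simp [zetaWeight]

theorem zetaWeight_zeta (l : List (Fin 3)) : zetaWeight (zeta l) = etaPlus * zetaWeight l := by
  have h := ratio_mul_etaPlus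
  have h' := ratio_spec
  induction l with
  | nil => simp [zeta, zetaWeight]
  | cons t l ih =>
    have hc : zetaWeight (t :: l) = zetaWeight [t] + zetaWeight l := zetaWeight_append [t] l
    rw [zeta_cons, zetaWeight_append, ih, hc, mul_add]
    congr 1
    fin_cases t <;> simp [zetaLetter, zetaWeight]
    · linear_combination -ratio * h
    · linear_combination -h
    · linear_combination (-1 - ratio - ratio ^ 2) * h / 2 + etaPlus / 2 * h'

theorem length_le_zetaWeight (l : List (Fin 3)) : ratio ^ 2 * l.length ≤ zetaWeight l := by
  have h1 := ratio_pos
  have h2 := ratio_lt_one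
  induction l with
  | nil => simp [zetaWeight]
  | cons t l ih =>
    have hc : zetaWeight (t :: l) = zetaWeight [t] + zetaWeight l := zetaWeight_append [t] l
    have ht : ratio ^ 2 ≤ zetaWeight [t] := by
      have h3 : |ratio| ≤ 1 := by rw [abs_of_pos h1]; exact h2.le
      fin_cases t <;> simp [zetaWeight] <;> nlinarith
    rw [hc, List.length_cons, Nat.cast_succ]
    linarith

theorem length_zetaIter_le (k : ℕ) :
    ((zetaIter k).length : ℝ) ≤ 2 / ratio ^ 2 * etaPlus ^ k := by
  have h : zetaWeight (zetaIter k) = 2 * etaPlus ^ k := by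
    induction k with
    | zero =>
      change zetaWeight [2, 2] = _
      simp [zetaWeight]; norm_num
    | succ k ih =>
      rw [zetaIter, Function.iterate_succ_apply', zetaWeight_zeta, ← zetaIter, ih]; ring
  have h' := length_le_zetaWeight (zetaIter k)
  have := ratio_pos
  rw [div_mul_eq_mul_div, le_div_iff₀ (by positivity)]
  linarith

open SemidirectProduct

/-! ### Word norms -/

section WordNorm

variable {Γ : Type*} [Group Γ] {S : Set Γ}

theorem wordNorm_prod_le (l : List Γ) (h : ∀ s ∈ l, s ∈ S) : wordNorm S l.prod ≤ l.length :=
  Nat.sInf_le ⟨l, rfl, h, rfl⟩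

theorem exists_list_length_eq_wordNorm (hS : Submonoid.closure S = ⊤) (g : Γ) :
    ∃ l : List Γ, l.length = wordNorm S g ∧ (∀ s ∈ l, s ∈ S) ∧ l.prod = g := by
  have hg : g ∈ Submonoid.closure S := hS ▸ Submonoid.mem_top g
  obtain ⟨l, hl, hlg⟩ := Submonoid.exists_list_of_mem_closure hg
  exact Nat.sInf_mem (s := {n | ∃ l : List Γ, l.length = n ∧ (∀ s ∈ l, s ∈ S) ∧ l.prod = g})
    ⟨l.length, l, rfl, hl, hlg⟩

theorem wordNorm_mul_le (hS : Submonoid.closure S = ⊤) (g h : Γ) :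
    wordNorm S (g * h) ≤ wordNorm S g + wordNorm S h := by
  obtain ⟨l, hl, hlS, rfl⟩ := exists_list_length_eq_wordNorm hS g
  obtain ⟨m, hm, hmS, rfl⟩ := exists_list_length_eq_wordNorm hS h
  rw [← hl, ← hm, ← List.prod_append, ← List.length_append]
  refine wordNorm_prod_le _ fun s hs => ?_
  rcases List.mem_append.1 hs with h | h
  exacts [hlS s h, hmS s h]

theorem wordNorm_list_prod_le (hS : Submonoid.closure S = ⊤) (M : ℕ) (l : List Γ)
    (h : ∀ s ∈ l, wordNorm S s ≤ M) : wordNorm S l.prod ≤ l.length * M := by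
  induction l with
  | nil => simpa using wordNorm_prod_le (S := S) [] (by simp)
  | cons s l ih =>
    rw [List.prod_cons, List.length_cons, add_mul, one_mul, add_comm]
    exact (wordNorm_mul_le hS _ _).trans
      (add_le_add (h s (by simp)) (ih fun t ht => h t (by simp [ht])))

theorem finite_setOf_wordNorm_le (hS : Submonoid.closure S = ⊤) (hf : S.Finite) (R : ℝ) :
    {g : Γ | (wordNorm S g : ℝ) ≤ R}.Finite := by
  have h : {l : List Γ | (∀ s ∈ l, s ∈ S) ∧ l.length ≤ ⌊R⌋₊}.Finite := by
    have := hf.to_subtype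
    refine ((List.finite_length_le S ⌊R⌋₊).image (List.map Subtype.val)).subset ?_
    rintro l ⟨hl, hlen⟩
    exact ⟨l.attach.map fun x => ⟨x.1, hl _ x.2⟩, by simpa using hlen, by simp⟩
  refine (h.image List.prod).subset fun g hg => ?_
  obtain ⟨l, hl, hlS, rfl⟩ := exists_list_length_eq_wordNorm hS g
  exact ⟨l, ⟨hlS, hl ▸ Nat.le_floor hg⟩, rfl⟩

theorem natCast_ncard_le_growth (hS : Submonoid.closure S = ⊤) (hf : S.Finite) {A : Set Γ} {R : ℝ}
    (hA : ∀ g ∈ A, (wordNorm S g : ℝ) ≤ R) : (A.ncard : ℝ) ≤ growth S R :=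
  Nat.cast_le.2 (Set.ncard_le_ncard hA (finite_setOf_wordNorm_le hS hf R))

end WordNorm

/-! ### Generators of wreath products -/

section Single

variable {X H : Type*} [Group H]

open Classical in
/-- The function with value `h` at `q`, and trivial elsewhere. -/
noncomputable def single (q : X) (h : H) : restrictedPower X H :=
  ⟨Pi.mulSingle q h, (Set.finite_singleton q).subset Pi.mulSupport_mulSingle_subset⟩

theorem single_same (q : X) (h : H) : (single q h).1 q = h := by simp [single]

theorem single_of_ne {q r : X} (hr : r ≠ q) (h : H) : (single q h).1 r = 1 := by
  simp [single, hr]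

theorem restrictedPower_induction {P : restrictedPower X H → Prop} (one : P 1)
    (mul : ∀ q h f, P f → P (single q h * f)) (f : restrictedPower X H) : P f := by
  have key : ∀ (s : Finset X) (f : restrictedPower X H), (∀ x, f.1 x ≠ 1 → x ∈ s) → P f := by
    intro s
    classical
    induction s using Finset.induction_on with
    | empty =>
      intro f hf
      have : f = 1 := Subtype.ext (funext fun x => by
        by_contra h; simpa using hf x h)
      exact this ▸ one
    | insert q s _ ih =>
      intro f hf
      rw [← mul_inv_cancel_left (single q (f.1 q)) f]
      refine mul _ _ _ (ih _ fun x hx => ?_)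
      change (single q (f.1 q)).1⁻¹ x * f.1 x ≠ 1 at hx
      by_cases hxq : x = q
      · subst hxq; simp [single_same] at hx
      · have hx' : f.1 x ≠ 1 := by simpa [single_of_ne hxq] using hx
        exact (Finset.mem_insert.1 (hf x hx')).resolve_left hxq
  exact key (Set.Finite.toFinset f.2) f fun x hx => (Set.Finite.mem_toFinset _).2 hx

theorem inr_mul_inl_single {G : Type*} [Group G] (ρ : G →* Sym X) (g : G) (q : X) (h : H) :
    (inr g * inl (single (Sym.app (ρ g) q) h) : Wreath H ρ) = inl (single q h) * inr g := by
  have : single q h = translateHom H ρ g (single (Sym.app (ρ g) q) h) := by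
    refine Subtype.ext (funext fun x => ?_)
    rw [translateHom_apply]
    by_cases hx : x = q
    · rw [hx, single_same, single_same]
    · rw [single_of_ne hx,
        single_of_ne (show Sym.app (ρ g) x ≠ Sym.app (ρ g) q from fun h => hx ((ρ g).unop.injective h))]
  rw [this, inl_aut, map_inv, inv_mul_cancel_right]

end Single

variable {H : Type*} [Group H]

/-- The image of `g` in the group `G_ω`. -/
abbrev mkG (ω : Omega) (g : F) : G ω := QuotientGroup.mk g

/-- The point `ξ` of its orbit. -/
def basePoint (ω : Omega) (ξ : Ray) : Orbit ω ξ := ⟨ξ, 1, by rw [map_one]; rfl⟩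

theorem exists_eq_basePoint (ω : Omega) (ξ : Ray) (q : Orbit ω ξ) :
    ∃ g : F, q = Sym.app (orbitHom ω ξ (mkG ω g)) (basePoint ω ξ) := by
  obtain ⟨ζ, g, rfl⟩ := q
  obtain ⟨g, rfl⟩ := QuotientGroup.mk_surjective g
  exact ⟨g, rfl⟩

/-- The standard generators of `W_ω(H)`. -/
def stdGens (ω : Omega) (ξ : Ray) (H : Type*) [Group H] : Set (W ω ξ H) :=
  (Set.range fun x : Letter => inr (mkG ω (gen x))) ∪
    Set.range fun h : H => inl (single (basePoint ω ξ) h)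

instance : Finite Letter :=
  Finite.of_surjective ![Letter.a, .b, .c, .d] fun x => by
    cases x
    exacts [⟨0, rfl⟩, ⟨1, rfl⟩, ⟨2, rfl⟩, ⟨3, rfl⟩]

theorem stdGens_finite [Finite H] (ω : Omega) (ξ : Ray) : (stdGens ω ξ H).Finite :=
  (Set.finite_range _).union (Set.finite_range _)

theorem inr_mem_closure_stdGens (ω : Omega) (ξ : Ray) (g : F) :
    (inr (mkG ω g) : W ω ξ H) ∈ Submonoid.closure (stdGens ω ξ H) := by
  obtain ⟨g, rfl⟩ := PresentedGroup.mk_surjective relators g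
  have hx : ∀ x, (inr (mkG ω (gen x)) : W ω ξ H) ∈ Submonoid.closure (stdGens ω ξ H) :=
    fun x => Submonoid.subset_closure (Or.inl ⟨x, rfl⟩)
  induction g using FreeGroup.induction_on with
  | C1 => rw [map_one]; exact one_mem _
  | of x => exact hx x
  | inv_of x _ =>
    rw [map_inv]
    change (inr (mkG ω (gen x)⁻¹) : W ω ξ H) ∈ _
    rw [gen_eq_inv]; exact hx x
  | mul g h hg hh =>
    rw [map_mul, mkG, QuotientGroup.mk_mul, map_mul]
    exact mul_mem hg hh

theorem closure_stdGens (ω : Omega) (ξ : Ray) : Submonoid.closure (stdGens ω ξ H) = ⊤ := by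
  rw [eq_top_iff]
  rintro ⟨f, g⟩ -
  rw [mk_eq_inl_mul_inr]
  refine mul_mem ?_ ?_
  · induction f using restrictedPower_induction with
    | one => rw [map_one]; exact one_mem _
    | mul q h f hf =>
      rw [map_mul]
      refine mul_mem ?_ hf
      obtain ⟨g, rfl⟩ := exists_eq_basePoint ω ξ q
      have := inr_mul_inl_single (orbitHom ω ξ) (mkG ω g) (basePoint ω ξ) h
      rw [← inv_mul_eq_iff_eq_mul.2 this.symm, ← map_inv] at *
      refine mul_mem (inr_mem_closure_stdGens ω ξ g⁻¹) (mul_mem ?_ (inr_mem_closure_stdGens ω ξ g))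
      exact Submonoid.subset_closure (Or.inr ⟨h, rfl⟩)
  · obtain ⟨g, rfl⟩ := QuotientGroup.mk_surjective g
    exact inr_mem_closure_stdGens ω ξ g

/-- A function supported on the points `ξ · s`, for the suffixes `s` of `l`, can be inserted in
the word `l` at the cost of one more generator for each suffix. -/
theorem exists_list_of_support (ω : Omega) (ξ : Ray) (l : List (Fin 3)) :
    ∀ f : restrictedPower (Orbit ω ξ) H,
      (∀ q, f.1 q ≠ 1 → ∃ s, s ≠ [] ∧ s <:+ l ∧ move ω (val (ω 0) s) ξ = q.1) →
      ∃ m : List (W ω ξ H), m.length = 3 * l.length ∧ (∀ s ∈ m, s ∈ stdGens ω ξ H) ∧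
        m.prod = inr (mkG ω (val (ω 0) l)) * inl f := by
  induction l with
  | nil =>
    intro f hf
    have : f = 1 := Subtype.ext (funext fun q => by
      by_contra h
      obtain ⟨s, hs, hs', -⟩ := hf q h
      exact hs (List.suffix_nil.1 hs'))
    subst this
    exact ⟨[], rfl, by simp, by simp⟩
  | cons t l ih =>
    intro f hf
    set g := val (ω 0) (t :: l) with hg
    set q := Sym.app (orbitHom ω ξ (mkG ω g)) (basePoint ω ξ) with hq
    obtain ⟨m, hm, hmS, hmp⟩ := ih ((single q (f.1 q))⁻¹ * f) fun r hr => by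
      change (single q (f.1 q)).1⁻¹ r * f.1 r ≠ 1 at hr
      by_cases hrq : r = q
      · subst hrq; simp [single_same] at hr
      · obtain ⟨s, hs, hsl, hsr⟩ := hf r (by simpa [single_of_ne hrq] using hr)
        refine ⟨s, hs, (List.suffix_cons_iff.1 hsl).resolve_left ?_, hsr⟩
        rintro rfl
        exact hrq (Subtype.ext hsr.symm)
    refine ⟨inl (single (basePoint ω ξ) (f.1 q)) :: inr (mkG ω (gen .a)) ::
      inr (mkG ω (letter (ω 0) t)) :: m, by simp [hm]; ring, ?_, ?_⟩
    · simp only [List.mem_cons]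
      rintro s (rfl | rfl | rfl | hs)
      exacts [Or.inr ⟨_, rfl⟩, Or.inl ⟨_, rfl⟩, Or.inl ⟨_, rfl⟩, hmS s hs]
    · rw [List.prod_cons, List.prod_cons, List.prod_cons, hmp]
      have h1 := inr_mul_inl_single (orbitHom ω ξ) (mkG ω g) (basePoint ω ξ) (f.1 q)
      have h2 : (inr (mkG ω g) : W ω ξ H) = inr (mkG ω (gen .a)) *
          (inr (mkG ω (letter (ω 0) t)) * inr (mkG ω (val (ω 0) l))) := by
        rw [← map_mul, ← map_mul, hg, val_cons]; rfl
      have h3 : inl f = (inl (single q (f.1 q)) * inl ((single q (f.1 q))⁻¹ * f) : W ω ξ H) := by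
        rw [← map_mul, mul_inv_cancel_left]
      rw [h3, ← mul_assoc (inr (mkG ω g)), h1, h2]
      simp only [mul_assoc]

theorem two_pow_le_growth [Finite H] [Nontrivial H] {ω : Omega} (hω : IsCyclic ω) (ξ : Ray)
    {S : Set (W ω ξ H)} (hS : Submonoid.closure S = ⊤) (hf : S.Finite) {M : ℕ}
    (hM : ∀ s ∈ stdGens ω ξ H, wordNorm S s ≤ M) (k : ℕ) :
    (2 : ℝ) ^ 2 ^ k ≤ growth S (3 * (zetaIter k).length * M) := by
  classical
  set l := zetaIter k
  set D := suffixPoints ω l ξ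
  have hD : D.Finite := suffixPoints_finite _ _ _
  obtain ⟨h, hh⟩ := exists_ne (1 : H)
  let φ : Set Ray → Orbit ω ξ → H := fun A q => if q.1 ∈ A then h else 1
  have hφ : ∀ A ⊆ D, (Function.mulSupport (φ A)).Finite := fun A hA =>
    ((hD.subset hA).preimage Subtype.val_injective.injOn).subset fun q hq => by
      by_contra hqA
      exact hq (if_neg hqA)
  let ψ : Set Ray → W ω ξ H := fun A =>
    if hA : A ⊆ D then inr (mkG ω (val (ω 0) l)) * inl ⟨φ A, hφ A hA⟩ else 1
  have hψ : Set.InjOn ψ (𝒫 D) := by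
    have key : ∀ A ⊆ D, ∀ B ⊆ D, ψ A = ψ B → A ⊆ B := fun A hA B hB hAB ζ hζ => by
      simp only [ψ, dif_pos hA, dif_pos hB, mul_right_inj, inl_inj] at hAB
      obtain ⟨s, -, -, -, hs⟩ := hA hζ
      have := congrFun (congrArg Subtype.val hAB) ⟨ζ, mkG ω _, hs⟩
      by_contra hζB
      simp only [φ, if_pos hζ, if_neg hζB] at this
      exact hh this
    exact fun A hA B hB hAB => (key A hA B hB hAB).antisymm (key B hB A hA hAB.symm)
  calc (2 : ℝ) ^ 2 ^ k ≤ 2 ^ D.ncard :=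
        pow_le_pow_right₀ one_le_two (two_pow_le_ncard_suffixPoints k hω ξ)
    _ = ((ψ '' 𝒫 D).ncard : ℝ) := by
        rw [hψ.ncard_image, Set.ncard_powerset _ hD]; norm_num
    _ ≤ _ := by
        refine natCast_ncard_le_growth hS hf ?_
        rintro _ ⟨A, hA, rfl⟩
        simp only [ψ, dif_pos (show A ⊆ D from hA)]
        obtain ⟨m, hm, hmS, hmp⟩ := exists_list_of_support ω ξ l ⟨φ A, hφ A hA⟩ fun q hq => by
          have hqA : q.1 ∈ A := by
            by_contra hqA
            exact hq (if_neg hqA)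
          obtain ⟨s, h1, -, h3, h4⟩ := hA hqA
          exact ⟨s, h1, h3, h4⟩
        rw [← hmp]
        have := wordNorm_list_prod_le hS M m fun s hs => hM s (hmS s hs)
        rw [hm] at this
        exact_mod_cast this

/-! ### Sections in the groups `G_ω` and their wreath products -/

theorem kernelSeq_monotone (ω : Omega) : Monotone fun i => kernelSeq i ω :=
  monotone_nat_of_le_succ fun i => kernelSeq_le_succ i ω

theorem mem_kernel_iff (ω : Omega) (g : F) :
    g ∈ kernel ω ↔ perm (ω 0) g = 1 ∧ ∀ y, sec (ω 0) g y ∈ kernel (shift ω) := by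
  simp only [mem_kernel]
  constructor
  · rintro ⟨i, hi⟩
    have := (mem_kernelSeq_succ i ω g).1 (kernelSeq_le_succ i ω hi)
    exact ⟨this.1, fun y => ⟨i, this.2 y⟩⟩
  · rintro ⟨hp, h⟩
    choose n hn using h
    refine ⟨max (n 0) (n 1) + 1, (mem_kernelSeq_succ _ ω g).2 ⟨hp, fun y => ?_⟩⟩
    have : n y ≤ max (n 0) (n 1) := by
      obtain rfl | rfl : y = 0 ∨ y = 1 := by omega
      exacts [le_max_left _ _, le_max_right _ _]
    exact kernelSeq_monotone _ this (hn y)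

/-- The action of `G_ω` on the first digit. -/
def permG (ω : Omega) : G ω →* Sym (Fin 2) :=
  QuotientGroup.lift (kernel ω) (perm (ω 0)) fun g hg => ((mem_kernel_iff ω g).1 hg).1

/-- The sections of the elements of `G_ω`. -/
def secG (ω : Omega) (y : Fin 2) (g : G ω) : G (shift ω) :=
  Quotient.liftOn' g (fun g => mkG (shift ω) (sec (ω 0) g y)) fun g h hgh => by
    rw [QuotientGroup.leftRel_apply] at hgh
    refine QuotientGroup.eq.2 ?_
    have h1 : sec (ω 0) h y = sec (ω 0) (g * (g⁻¹ * h)) y := by rw [mul_inv_cancel_left]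
    rw [h1, sec_mul, inv_mul_cancel_left]
    exact ((mem_kernel_iff ω _).1 hgh).2 _

theorem secG_mkG (ω : Omega) (y : Fin 2) (g : F) :
    secG ω y (mkG ω g) = mkG (shift ω) (sec (ω 0) g y) := rfl

theorem secG_mul (ω : Omega) (y : Fin 2) (g h : G ω) :
    secG ω y (g * h) = secG ω y g * secG ω (Sym.app (permG ω g) y) h := by
  obtain ⟨g, rfl⟩ := QuotientGroup.mk_surjective g
  obtain ⟨h, rfl⟩ := QuotientGroup.mk_surjective h
  rw [← QuotientGroup.mk_mul, secG_mkG, sec_mul]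
  rfl

theorem secG_injective (ω : Omega) {g h : G ω} (hp : permG ω g = permG ω h)
    (hs : ∀ y, secG ω y g = secG ω y h) : g = h := by
  obtain ⟨g, rfl⟩ := QuotientGroup.mk_surjective g
  obtain ⟨h, rfl⟩ := QuotientGroup.mk_surjective h
  have hp' : perm (ω 0) g = perm (ω 0) h := hp
  refine QuotientGroup.eq.2 ((mem_kernel_iff ω _).2
    ⟨by rw [map_mul, map_inv, hp', inv_mul_cancel], fun y => ?_⟩)
  set z := Sym.app (perm (ω 0) g⁻¹) y
  have h1 : sec (ω 0) g⁻¹ y * sec (ω 0) g z = 1 := by rw [← sec_mul, inv_mul_cancel, sec_one]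
  rw [sec_mul, eq_inv_of_mul_eq_one_left h1]
  exact QuotientGroup.eq.1 (hs z)

theorem app_rayHom_snoc (ω : Omega) (g : G ω) (y : Fin 2) (ζ : Ray) :
    Sym.app (rayHom ω g) (snoc y ζ) =
      snoc (Sym.app (permG ω g) y) (Sym.app (rayHom (shift ω) (secG ω y g)) ζ) := by
  obtain ⟨g, rfl⟩ := QuotientGroup.mk_surjective g
  exact move_snoc ω g y ζ

/-- The wreath product of `H` with `G_ω` over the set of all rays. -/
abbrev FullW (ω : Omega) (H : Type*) [Group H] : Type _ := Wreath H (rayHom ω)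

/-- The restriction of `f` to the rays ending in `y`. -/
def restr (y : Fin 2) (f : restrictedPower Ray H) : restrictedPower Ray H :=
  ⟨fun ζ => f.1 (snoc y ζ), Set.Finite.preimage (snoc_injective y).injOn f.2⟩

/-- The component of `w` at the digit `y`. -/
def comp (ω : Omega) (y : Fin 2) (w : FullW ω H) : FullW (shift ω) H :=
  ⟨restr y w.left, secG ω y w.right⟩

theorem comp_mul (ω : Omega) (y : Fin 2) (v w : FullW ω H) :
    comp ω y (v * w) = comp ω y v * comp ω (Sym.app (permG ω v.right) y) w := by
  refine SemidirectProduct.ext (Subtype.ext (funext fun ζ => ?_)) (secG_mul ω y _ _)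
  rw [Wreath.mul_left_apply]
  change (v * w).left.1 (snoc y ζ) = v.left.1 (snoc y ζ) * w.left.1 (snoc _ _)
  rw [Wreath.mul_left_apply, app_rayHom_snoc]
  rfl

theorem comp_injective (ω : Omega) :
    Function.Injective fun w : FullW ω H => (permG ω w.right, comp ω 0 w, comp ω 1 w) := by
  intro v w h
  simp only [Prod.mk.injEq] at h
  obtain ⟨hp, h0, h1⟩ := h
  have hc : ∀ y, comp ω y v = comp ω y w := fun y => by
    obtain rfl | rfl : y = 0 ∨ y = 1 := by omega
    exacts [h0, h1]
  refine SemidirectProduct.ext (Subtype.ext (funext fun ξ => ?_))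
    (secG_injective ω hp fun y => congrArg SemidirectProduct.right (hc y))
  have := congrFun (congrArg (fun u => u.left.1) (hc (ξ 0))) (GrigorchukWreath.shift ξ)
  change v.left.1 (snoc _ _) = w.left.1 (snoc _ _) at this
  rwa [snoc_shift] at this

/-! ### Weighted words -/

/-- The points `ξ · aᵉ x`, for `e ∈ {0, 1}` and `x ∈ {1, b, c, d}`. -/
def near (ω : Omega) (ξ : Ray) : Set Ray :=
  Set.range fun p : Bool × Option (Fin 3) =>
    move ω ((if p.1 then gen .a else 1) * vgen (ω 0) p.2) ξ

theorem vgen_sq (i : Fin 3) (x : Option (Fin 3)) : vgen i x * vgen i x = 1 := by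
  cases x
  exacts [one_mul 1, letter_sq _ _]

theorem move_vgen_mem_near (ω : Omega) (ξ : Ray) (x : Option (Fin 3)) (ζ : Ray) :
    move ω (vgen (ω 0) x) ζ ∈ near ω ξ ↔ ζ ∈ near ω ξ := by
  have h : ∀ ζ, ζ ∈ near ω ξ → move ω (vgen (ω 0) x) ζ ∈ near ω ξ := by
    rintro _ ⟨⟨e, z⟩, rfl⟩
    obtain ⟨z', hz', -⟩ := vgen_mul (ω 0) z x
    exact ⟨⟨e, z'⟩, by simp only [← move_mul, mul_assoc, hz']⟩
  refine ⟨fun hζ => ?_, h ζ⟩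
  have := h _ hζ
  rwa [← move_mul, vgen_sq, move_one] at this

theorem sec_vgen {ω : Omega} (hω : IsCyclic ω) (x : Option (Fin 3)) (y : Fin 2) :
    sec (ω 0) (vgen (ω 0) x) y = gen .a ∨ ∃ z, sec (ω 0) (vgen (ω 0) x) y = vgen (shift ω 0) z := by
  rcases x with _ | t
  · exact Or.inr ⟨none, sec_one _ _⟩
  · obtain rfl | rfl : y = 0 ∨ y = 1 := by omega
    · by_cases ht : t = 0
      · exact Or.inr ⟨none, by simp [vgen, ht]⟩
      · exact Or.inl (by simp [vgen, ht])
    · exact Or.inr ⟨some (t - 1), by simp [vgen, hω.shift_zero]⟩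

theorem shift_mem_near {ω : Omega} (hω : IsCyclic ω) {ξ ζ : Ray} (h : ζ ∈ near ω ξ) :
    GrigorchukWreath.shift ζ ∈ near (shift ω) (GrigorchukWreath.shift ξ) := by
  obtain ⟨⟨e, x⟩, rfl⟩ := h
  have : ∃ y, sec (ω 0) ((if e then gen .a else 1) * vgen (ω 0) x) (ξ 0) =
      sec (ω 0) (vgen (ω 0) x) y := by
    cases e
    · exact ⟨_, by simp; rfl⟩
    · exact ⟨_, by simp; rfl⟩
  obtain ⟨y, hy⟩ := this
  change move (GrigorchukWreath.shift ω) (sec (ω 0) _ (ξ 0)) _ ∈ _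
  rw [hy]
  rcases sec_vgen hω x y with h | ⟨z, h⟩ <;> rw [h]
  · exact ⟨(true, none), by simp [vgen]⟩
  · exact ⟨(false, z), by simp⟩

/-- The property that the support of `f` is near `ξ`. -/
def SuppNear (ω : Omega) (ξ : Ray) (f : restrictedPower Ray H) : Prop :=
  ∀ ζ, f.1 ζ ≠ 1 → ζ ∈ near ω ξ

theorem SuppNear.one (ω : Omega) (ξ : Ray) : SuppNear ω ξ (1 : restrictedPower Ray H) :=
  fun _ h => absurd rfl h

theorem SuppNear.restr {ω : Omega} (hω : IsCyclic ω) {ξ : Ray} {f : restrictedPower Ray H}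
    (h : SuppNear ω ξ f) (y : Fin 2) :
    SuppNear (shift ω) (GrigorchukWreath.shift ξ) (restr y f) := fun ζ hζ =>
  shift_mem_near hω (h (snoc y ζ) hζ)

/-- The element `f x`. -/
def kEl (ω : Omega) (f : restrictedPower Ray H) (x : Option (Fin 3)) : FullW ω H :=
  inl f * inr (mkG ω (vgen (ω 0) x))

/-- The element `a`. -/
def aEl (ω : Omega) (H : Type*) [Group H] : FullW ω H := inr (mkG ω (gen .a))

theorem kEl_one_none (ω : Omega) : kEl ω (1 : restrictedPower Ray H) none = 1 := by
  rw [kEl, map_one, one_mul]; exact map_one _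

theorem exists_kEl_mul_kEl {ω : Omega} {ξ : Ray} {f f' : restrictedPower Ray H}
    (hf : SuppNear ω ξ f) (hf' : SuppNear ω ξ f') (x x' : Option (Fin 3)) :
    ∃ f'' x'', SuppNear ω ξ f'' ∧ kEl ω f x * kEl ω f' x' = kEl ω f'' x'' ∧
      wt x'' ≤ wt x + wt x' := by
  obtain ⟨z, hz, hwt⟩ := vgen_mul (ω 0) x x'
  refine ⟨f * translateHom H (rayHom ω) (mkG ω (vgen (ω 0) x)) f', z, fun ζ hζ => ?_, ?_, hwt⟩
  · change f.1 ζ * f'.1 (move ω (vgen (ω 0) x) ζ) ≠ 1 at hζ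
    by_contra hn
    have h1 : f.1 ζ = 1 := by by_contra h; exact hn (hf _ h)
    have h2 : f'.1 (move ω (vgen (ω 0) x) ζ) = 1 := by
      by_contra h; exact hn ((move_vgen_mem_near _ _ _ _).1 (hf' _ h))
    rw [h1, h2, one_mul] at hζ
    exact hζ rfl
  · have h : (inr (mkG ω (vgen (ω 0) z)) : FullW ω H) =
        inr (mkG ω (vgen (ω 0) x)) * inr (mkG ω (vgen (ω 0) x')) := by
      rw [← hz, ← map_mul]; rfl
    rw [kEl, kEl, kEl, map_mul, inl_aut, h, map_inv]
    group

/-- `Rep ω ξ L w` means that `w = k₀ a k₁ a … a kₙ`, with `kᵢ = fᵢ xᵢ` and `fᵢ` supported near `ξ`,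
and that the weight of `x₀ a x₁ a … a xₙ` is at most `L`. -/
inductive Rep (ω : Omega) (ξ : Ray) : ℝ → FullW ω H → Prop
  | base {f : restrictedPower Ray H} (hf : SuppNear ω ξ f) (x : Option (Fin 3)) {L : ℝ}
      (hL : wt x ≤ L) : Rep ω ξ L (kEl ω f x)
  | step {f : restrictedPower Ray H} (hf : SuppNear ω ξ f) (x : Option (Fin 3)) {M L : ℝ}
      {w : FullW ω H} (hw : Rep ω ξ M w) (hL : wt x + wtA + M ≤ L) :
      Rep ω ξ L (kEl ω f x * (aEl ω H * w))

namespace Rep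

variable {ω : Omega} {ξ : Ray}

theorem one : Rep ω ξ 0 (1 : FullW ω H) :=
  kEl_one_none (H := H) ω ▸ Rep.base (SuppNear.one _ _) none le_rfl

theorem mono {L L' : ℝ} {w : FullW ω H} (h : Rep ω ξ L w) (hL : L ≤ L') : Rep ω ξ L' w := by
  cases h with
  | base hf x h => exact Rep.base hf x (h.trans hL)
  | step hf x hw h => exact Rep.step hf x hw (h.trans hL)

theorem kEl_mul {L : ℝ} {w : FullW ω H} (h : Rep ω ξ L w) {f : restrictedPower Ray H}
    (hf : SuppNear ω ξ f) (x : Option (Fin 3)) : Rep ω ξ (wt x + L) (kEl ω f x * w) := by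
  cases h with
  | base hf' x' h =>
    obtain ⟨f'', x'', hf'', he, hx''⟩ := exists_kEl_mul_kEl hf hf' x x'
    exact he ▸ Rep.base hf'' x'' (by linarith)
  | step hf' x' hw h =>
    obtain ⟨f'', x'', hf'', he, hx''⟩ := exists_kEl_mul_kEl hf hf' x x'
    rw [← mul_assoc, he]
    exact Rep.step hf'' x'' hw (by linarith)

theorem aEl_mul {L : ℝ} {w : FullW ω H} (h : Rep ω ξ L w) : Rep ω ξ (wtA + L) (aEl ω H * w) := by
  have := Rep.step (SuppNear.one ω ξ) none h le_rfl
  rw [kEl_one_none, one_mul] at this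
  exact this.mono (by simp [wt])

theorem mul {L M : ℝ} {v w : FullW ω H} (hv : Rep ω ξ L v) (hw : Rep ω ξ M w) :
    Rep ω ξ (L + M) (v * w) := by
  induction hv with
  | base hf x h => exact (hw.kEl_mul hf x).mono (by linarith)
  | step hf x _ h ih =>
    rw [mul_assoc, mul_assoc]
    exact Rep.step hf x ih (by linarith)

end Rep

theorem comp_aEl_mul (ω : Omega) (y : Fin 2) (w : FullW ω H) :
    comp ω y (aEl ω H * w) = comp ω (Sym.app flip y) w := by
  have h : comp ω y (aEl ω H) = 1 := by
    refine SemidirectProduct.ext rfl ?_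
    change secG ω y (mkG ω (gen .a)) = 1
    rw [secG_mkG, sec_a]; rfl
  rw [comp_mul, h, one_mul]
  change comp ω (Sym.app (perm (ω 0) (gen .a)) y) w = _
  rw [perm_a]

theorem comp_kEl (ω : Omega) (y : Fin 2) (f : restrictedPower Ray H) (x : Option (Fin 3)) :
    comp ω y (kEl ω f x) =
      inl (restr y f) * inr (mkG (shift ω) (sec (ω 0) (vgen (ω 0) x) y)) := by
  rw [← mk_eq_inl_mul_inr, kEl, ← mk_eq_inl_mul_inr]; rfl

theorem comp_kEl_mul (ω : Omega) (y : Fin 2) (f : restrictedPower Ray H) (x : Option (Fin 3))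
    (w : FullW ω H) : comp ω y (kEl ω f x * w) = comp ω y (kEl ω f x) * comp ω y w := by
  rw [comp_mul]
  congr 2
  rw [kEl, ← mk_eq_inl_mul_inr]
  change Sym.app (perm (ω 0) (vgen (ω 0) x)) y = y
  rw [perm_vgen]; rfl

/-- The total weight of the two components of `f x` is at most the contraction ratio times the
weight of `x a`. -/
theorem exists_rep_comp_kEl {ω : Omega} (hω : IsCyclic ω) {ξ : Ray} {f : restrictedPower Ray H}
    (hf : SuppNear ω ξ f) (x : Option (Fin 3)) :
    ∃ c : Fin 2 → ℝ, c 0 + c 1 ≤ ratio * (wt x + wtA) ∧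
      ∀ y, Rep (shift ω) (GrigorchukWreath.shift ξ) (c y) (comp ω y (kEl ω f x)) := by
  have hv : ∀ (y : Fin 2) (z : Option (Fin 3)),
      sec (ω 0) (vgen (ω 0) x) y = vgen (shift ω 0) z →
      Rep (shift ω) (GrigorchukWreath.shift ξ) (wt z) (comp ω y (kEl ω f x)) := fun y z h => by
    rw [comp_kEl, h]; exact Rep.base (hf.restr hω y) z le_rfl
  have ha : ∀ y : Fin 2, sec (ω 0) (vgen (ω 0) x) y = gen .a →
      Rep (shift ω) (GrigorchukWreath.shift ξ) wtA (comp ω y (kEl ω f x)) := fun y h => by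
    rw [comp_kEl, h]
    have := Rep.step (hf.restr hω y) none Rep.one (le_refl _)
    rw [mul_one] at this
    have h1 : kEl (shift ω) (GrigorchukWreath.restr y f) none = inl (GrigorchukWreath.restr y f) :=
      (congrArg _ (map_one inr)).trans (mul_one _)
    rw [h1] at this
    exact this.mono (by simp [wt])
  have hA := wtA_pos
  have h0 := ratio_pos
  have h2 : (2 : Fin 3) - 1 = 1 := rfl
  have h3 : (0 : Fin 3) - 1 = 2 := rfl
  have key : ∀ y0 y1 : ℝ, y0 + y1 ≤ ratio * (wt x + wtA) →
      Rep (shift ω) (GrigorchukWreath.shift ξ) y0 (comp ω 0 (kEl ω f x)) →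
      Rep (shift ω) (GrigorchukWreath.shift ξ) y1 (comp ω 1 (kEl ω f x)) →
      ∃ c : Fin 2 → ℝ, c 0 + c 1 ≤ ratio * (wt x + wtA) ∧
        ∀ y, Rep (shift ω) (GrigorchukWreath.shift ξ) (c y) (comp ω y (kEl ω f x)) :=
    fun y0 y1 h h0 h1 => ⟨![y0, y1], h, fun y => by fin_cases y; exacts [h0, h1]⟩
  have hs := ratio_spec
  rcases x with _ | t
  · exact key _ _ (by simp [wt]; positivity) (hv 0 none (sec_one _ _)) (hv 1 none (sec_one _ _))
  have h4 := hv 1 (some (t - 1)) (by simp [vgen, hω.shift_zero])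
  by_cases ht : t = 0
  · subst ht
    refine key _ _ ?_ (hv 0 none (by simp [vgen])) h4
    simp [wt, wtA, h3]; nlinarith
  · refine key _ _ ?_ (ha 0 (by simp [vgen, ht])) h4
    fin_cases t
    · exact absurd rfl ht
    · simp [wt, wtA]; nlinarith
    · simp [wt, wtA, h2]; nlinarith

theorem Rep.exists_comp {ω : Omega} (hω : IsCyclic ω) {ξ : Ray} {L : ℝ} {w : FullW ω H}
    (h : Rep ω ξ L w) : ∃ L' : Fin 2 → ℝ, L' 0 + L' 1 ≤ ratio * (L + wtA) ∧
      ∀ y, Rep (shift ω) (GrigorchukWreath.shift ξ) (L' y) (comp ω y w) := by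
  have hr := ratio_pos
  induction h with
  | base hf x h =>
    obtain ⟨c, hc, hcy⟩ := exists_rep_comp_kEl hω hf x
    exact ⟨c, hc.trans (by gcongr), hcy⟩
  | step hf x _ h ih =>
    obtain ⟨L', hL', hw⟩ := ih
    obtain ⟨c, hc, hcy⟩ := exists_rep_comp_kEl hω hf x
    refine ⟨fun y => c y + L' (Sym.app flip y), ?_, fun y => ?_⟩
    · simp only [flip_zero, flip_one]
      have := mul_le_mul_of_nonneg_left h hr.le
      linarith
    · rw [comp_kEl_mul, comp_aEl_mul]
      exact (hcy y).mul (hw _)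

open scoped ENNReal

/-! ### Counting elements of bounded weight -/

/-- The elements `f x`, with `f` supported near `ξ`. -/
def kSet (ω : Omega) (ξ : Ray) (H : Type*) [Group H] : Set (FullW ω H) :=
  Set.range fun p : {f : restrictedPower Ray H // SuppNear ω ξ f} × Option (Fin 3) =>
    kEl ω p.1.1 p.2

/-- A bound for the number of the elements `f x`. -/
noncomputable def kCard (H : Type*) : ℕ := Nat.card (Bool × Option (Fin 3) → H) * 4

theorem encard_kSet_le [Finite H] (ω : Omega) (ξ : Ray) : (kSet ω ξ H).encard ≤ kCard H := by
  let r : {f : restrictedPower Ray H // SuppNear ω ξ f} → Bool × Option (Fin 3) → H :=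
    fun f p => f.1.1 (move ω ((if p.1 then gen .a else 1) * vgen (ω 0) p.2) ξ)
  have hr : Function.Injective r := fun f f' h => by
    refine Subtype.ext (Subtype.ext (funext fun ζ => ?_))
    by_cases hζ : ζ ∈ near ω ξ
    · obtain ⟨p, rfl⟩ := hζ
      exact congrFun h p
    · have h1 : f.1.1 ζ = 1 := by by_contra h; exact hζ (f.2 _ h)
      have h2 : f'.1.1 ζ = 1 := by by_contra h; exact hζ (f'.2 _ h)
      rw [h1, h2]
  have := Finite.of_injective r hr
  have h1 := Nat.card_le_card_of_injective r hr
  rw [kSet, ← Set.image_univ]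
  refine (Set.encard_image_le _ _).trans ?_
  rw [Set.encard_univ, ENat.card_eq_coe_natCard, Nat.cast_le, Nat.card_prod]
  exact Nat.mul_le_mul h1 (by simp)

/-- The elements `k₀ a k₁ a … a kₙ`. -/
def level (ω : Omega) (ξ : Ray) (H : Type*) [Group H] : ℕ → Set (FullW ω H)
  | 0 => kSet ω ξ H
  | n + 1 => (fun p : FullW ω H × FullW ω H => p.1 * (aEl ω H * p.2)) ''
      (kSet ω ξ H ×ˢ level ω ξ H n)

theorem encard_level_le [Finite H] (ω : Omega) (ξ : Ray) (n : ℕ) :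
    (level ω ξ H n).encard ≤ (kCard H ^ (n + 1) : ℕ) := by
  induction n with
  | zero => simpa [level] using encard_kSet_le (H := H) ω ξ
  | succ n ih =>
    refine (Set.encard_image_le _ _).trans ?_
    rw [Set.encard_prod, pow_succ', Nat.cast_mul]
    exact mul_le_mul' (encard_kSet_le ω ξ) ih

theorem Rep.exists_level {ω : Omega} {ξ : Ray} {L : ℝ} {w : FullW ω H} (h : Rep ω ξ L w) :
    ∃ n : ℕ, wtA * n ≤ L ∧ w ∈ level ω ξ H n := by
  induction h with
  | base hf x hL =>
    exact ⟨0, by simpa using (wt_nonneg x).trans hL, ⟨⟨⟨_, hf⟩, x⟩, rfl⟩⟩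
  | step hf x _ hL ih =>
    obtain ⟨n, hn, hw⟩ := ih
    refine ⟨n + 1, ?_, ⟨(_, _), ⟨⟨⟨⟨_, hf⟩, x⟩, rfl⟩, hw⟩, rfl⟩⟩
    have := wt_nonneg x
    push_cast
    linarith

/-- The supremum of `exp (-s L)` over the weights `L` of words representing `w`. -/
noncomputable def expWeight (ω : Omega) (ξ : Ray) (s : ℝ) (w : FullW ω H) : ℝ≥0∞ :=
  ⨆ (L : ℝ) (_ : Rep ω ξ L w), ENNReal.ofReal (Real.exp (-(s * L)))

/-- The growth series. -/
noncomputable def growthSeries (ω : Omega) (ξ : Ray) (H : Type*) [Group H] (s : ℝ) : ℝ≥0∞ :=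
  ∑' w : FullW ω H, expWeight ω ξ s w

theorem tsum_indicator_const {α : Type*} (A : Set α) (c : ℝ≥0∞) :
    ∑' x, A.indicator (fun _ => c) x = A.encard * c := by
  rw [← tsum_subtype A fun _ => c, ENNReal.tsum_set_const]

theorem encard_mul_le_growthSeries {ω : Omega} {ξ : Ray} {s L : ℝ} {A : Set (FullW ω H)}
    (hA : ∀ w ∈ A, Rep ω ξ L w) :
    A.encard * ENNReal.ofReal (Real.exp (-(s * L))) ≤ growthSeries ω ξ H s := by
  rw [← tsum_indicator_const]
  refine ENNReal.tsum_le_tsum fun w => ?_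
  by_cases hw : w ∈ A
  · rw [Set.indicator_of_mem hw]
    exact le_iSup₂_of_le L (hA w hw) le_rfl
  · rw [Set.indicator_of_notMem hw]; exact zero_le

/-- An exponent at which the growth series converges. -/
noncomputable def convExp (H : Type*) : ℝ := Real.log (2 * kCard H) / wtA

theorem one_le_kCard (H : Type*) [Finite H] [Nonempty H] : 1 ≤ kCard H :=
  Nat.one_le_iff_ne_zero.2 (mul_ne_zero Nat.card_pos.ne' four_ne_zero)

theorem convExp_nonneg (H : Type*) [Finite H] [Nonempty H] : 0 ≤ convExp H := by
  have h : (1 : ℝ) ≤ kCard H := by exact_mod_cast one_le_kCard H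
  exact div_nonneg (Real.log_nonneg (by linarith)) wtA_pos.le

theorem growthSeries_convExp_le [Finite H] (ω : Omega) (ξ : Ray) :
    growthSeries ω ξ H (convExp H) ≤ ENNReal.ofReal (2 * kCard H) := by
  have hk : (1 : ℝ) ≤ kCard H := by exact_mod_cast one_le_kCard H
  set c : ℕ → ℝ≥0∞ := fun n => ENNReal.ofReal (Real.exp (-(convExp H * (wtA * n)))) with hc
  have h1 : ∀ w : FullW ω H, expWeight ω ξ (convExp H) w ≤
      ∑' n, (level ω ξ H n).indicator (fun _ => c n) w := fun w => by
    refine iSup₂_le fun L hL => ?_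
    obtain ⟨n, hn, hw⟩ := hL.exists_level
    refine le_trans ?_ (ENNReal.le_tsum n)
    rw [Set.indicator_of_mem hw]
    refine ENNReal.ofReal_le_ofReal (Real.exp_le_exp.2 (neg_le_neg ?_))
    exact mul_le_mul_of_nonneg_left hn (convExp_nonneg H)
  have h2 : ∀ n : ℕ, ((kCard H ^ (n + 1) : ℕ) : ℝ≥0∞) * c n =
      ENNReal.ofReal (kCard H * (1 / 2) ^ n) := fun n => by
    rw [hc, ← ENNReal.ofReal_natCast, ← ENNReal.ofReal_mul (Nat.cast_nonneg _)]
    congr 1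
    have : Real.exp (-(convExp H * (wtA * n))) = ((2 * kCard H : ℝ)⁻¹) ^ n := by
      rw [convExp, ← mul_assoc, div_mul_cancel₀ _ wtA_pos.ne', mul_comm, Real.exp_neg,
        Real.exp_nat_mul, Real.exp_log (by linarith), inv_pow]
    rw [this, mul_inv, mul_pow]
    push_cast
    rw [pow_succ', one_div, mul_comm ((2 : ℝ)⁻¹ ^ n), mul_assoc, ← mul_assoc ((kCard H : ℝ) ^ n),
      ← mul_pow, mul_inv_cancel₀ (by linarith), one_pow, one_mul]
  calc growthSeries ω ξ H (convExp H)
      ≤ ∑' w : FullW ω H, ∑' n, (level ω ξ H n).indicator (fun _ => c n) w :=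
        ENNReal.tsum_le_tsum h1
    _ = ∑' n, ((level ω ξ H n).encard : ℝ≥0∞) * c n := by
        rw [ENNReal.tsum_comm]
        exact tsum_congr fun n => tsum_indicator_const _ _
    _ ≤ ∑' n, ((kCard H ^ (n + 1) : ℕ) : ℝ≥0∞) * c n :=
        ENNReal.tsum_le_tsum fun n => mul_le_mul_left (by
          exact_mod_cast encard_level_le (H := H) ω ξ n) _
    _ = ENNReal.ofReal (2 * kCard H) := by
        rw [tsum_congr h2, ← ENNReal.ofReal_tsum_of_nonneg (fun n => by positivity)
          (summable_geometric_two.mul_left _), tsum_mul_left, tsum_geometric_two, mul_comm]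

theorem growthSeries_ratio_mul_le {ω : Omega} (hω : IsCyclic ω) (ξ : Ray) {s : ℝ} (hs : 0 ≤ s) :
    growthSeries ω ξ H (ratio * s) ≤ ENNReal.ofReal (2 * Real.exp (ratio * s * wtA)) *
      growthSeries (shift ω) (shift ξ) H s ^ 2 := by
  set e : FullW (shift ω) H → ℝ≥0∞ := expWeight (shift ω) (shift ξ) s with he
  set E := ENNReal.ofReal (Real.exp (ratio * s * wtA)) with hE
  have h1 : ∀ w : FullW ω H, expWeight ω ξ (ratio * s) w ≤
      E * (e (comp ω 0 w) * e (comp ω 1 w)) := fun w => by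
    refine iSup₂_le fun L hL => ?_
    obtain ⟨L', hL', hw⟩ := hL.exists_comp hω
    have hy : ∀ y, ENNReal.ofReal (Real.exp (-(s * L' y))) ≤ e (comp ω y w) := fun y =>
      le_iSup₂_of_le (L' y) (hw y) le_rfl
    refine le_trans ?_ (mul_le_mul_right (mul_le_mul' (hy 0) (hy 1)) _)
    rw [hE, ← ENNReal.ofReal_mul (Real.exp_nonneg _), ← ENNReal.ofReal_mul (Real.exp_nonneg _),
      ← Real.exp_add, ← Real.exp_add]
    refine ENNReal.ofReal_le_ofReal (Real.exp_le_exp.2 ?_)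
    have := mul_le_mul_of_nonneg_left hL' hs
    linarith
  have hcard : ENat.card (Sym (Fin 2)) = 2 := by
    rw [ENat.card_congr MulOpposite.opEquiv.symm, ENat.card_eq_coe_fintype_card]
    rfl
  let F' : Sym (Fin 2) × FullW (shift ω) H × FullW (shift ω) H → ℝ≥0∞ :=
    fun p => e p.2.1 * e p.2.2
  calc growthSeries ω ξ H (ratio * s)
      ≤ ∑' w : FullW ω H, E * (e (comp ω 0 w) * e (comp ω 1 w)) := ENNReal.tsum_le_tsum h1
    _ = E * ∑' w : FullW ω H, F' (permG ω w.right, comp ω 0 w, comp ω 1 w) := ENNReal.tsum_mul_left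
    _ ≤ E * ∑' p, F' p := mul_le_mul_right
        (ENNReal.tsum_comp_le_tsum_of_injective (comp_injective ω) F') _
    _ = E * (2 * growthSeries (shift ω) (shift ξ) H s ^ 2) := by
        rw [ENNReal.tsum_prod']
        simp only [F', ENNReal.tsum_prod', ENNReal.tsum_mul_left, ENNReal.tsum_mul_right,
          ENNReal.tsum_const, hcard, ← he, growthSeries, pow_two]
        rw [mul_left_comm (∑' w, e w)]
        rfl
    _ = _ := by
        rw [← mul_assoc, hE, mul_comm (2 : ℝ), ENNReal.ofReal_mul (Real.exp_nonneg _)]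
        norm_num

/-- The base of the bound for the growth series. -/
noncomputable def growthBase (H : Type*) : ℝ :=
  2 * Real.exp (convExp H * wtA) * (2 * kCard H)

theorem growthSeries_pow_le [Finite H] (n : ℕ) : ∀ {ω : Omega}, IsCyclic ω → ∀ ξ : Ray,
    ENNReal.ofReal (2 * Real.exp (convExp H * wtA)) *
      growthSeries ω ξ H (ratio ^ n * convExp H) ≤ ENNReal.ofReal (growthBase H) ^ 2 ^ n := by
  induction n with
  | zero =>
    intro ω _ ξ
    rw [pow_zero, pow_zero, pow_one, one_mul, growthBase, 
      ENNReal.ofReal_mul (show 0 ≤ 2 * Real.exp (convExp H * wtA) by positivity)]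
    exact mul_le_mul_right (growthSeries_convExp_le (H := H) ω ξ) _
  | succ n ih =>
    intro ω hω ξ
    have h0 := convExp_nonneg H
    have hr := ratio_pos.le
    have h1 : 0 ≤ ratio ^ n * convExp H := by positivity
    have h2 : ratio * (ratio ^ n * convExp H) ≤ convExp H := by
      rw [← mul_assoc, ← pow_succ']
      exact mul_le_of_le_one_left h0 (pow_le_one₀ hr ratio_lt_one.le)
    set c := ENNReal.ofReal (2 * Real.exp (convExp H * wtA))
    calc c * growthSeries ω ξ H (ratio ^ (n + 1) * convExp H)
        ≤ c * (c * growthSeries (shift ω) (shift ξ) H (ratio ^ n * convExp H) ^ 2) := by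
          rw [pow_succ', mul_assoc]
          refine mul_le_mul_right ((growthSeries_ratio_mul_le hω ξ h1).trans
            (mul_le_mul_left (ENNReal.ofReal_le_ofReal ?_) _)) _
          have := wtA_pos
          gcongr
      _ = (c * growthSeries (shift ω) (shift ξ) H (ratio ^ n * convExp H)) ^ 2 := by ring
      _ ≤ (ENNReal.ofReal (growthBase H) ^ 2 ^ n) ^ 2 := pow_le_pow_left' (ih hω.shift _) 2
      _ = _ := by rw [← pow_mul, ← pow_succ]

theorem ncard_le_of_rep [Finite H] {ω : Omega} (hω : IsCyclic ω) {ξ : Ray} {L : ℝ}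
    {A : Set (FullW ω H)} (hA : ∀ w ∈ A, Rep ω ξ L w) (n : ℕ) :
    (A.ncard : ℝ) ≤ growthBase H ^ 2 ^ n * Real.exp (ratio ^ n * convExp H * L) := by
  have hB : 0 ≤ growthBase H := by unfold growthBase; positivity
  by_cases hf : A.Finite
  · have h0 := convExp_nonneg H
    have hE : 0 ≤ convExp H * wtA := mul_nonneg h0 wtA_pos.le
    have h1 : (1 : ℝ≥0∞) ≤ ENNReal.ofReal (2 * Real.exp (convExp H * wtA)) := by
      rw [ENNReal.one_le_ofReal]
      linarith [Real.one_le_exp hE]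
    have h2 := (encard_mul_le_growthSeries (s := ratio ^ n * convExp H) hA).trans
      ((le_mul_of_one_le_left' h1).trans (growthSeries_pow_le n hω ξ))
    rw [← hf.cast_ncard_eq, ← ENNReal.ofReal_pow hB, ENat.toENNReal_coe, ← ENNReal.ofReal_natCast,
      ← ENNReal.ofReal_mul (Nat.cast_nonneg _), ENNReal.ofReal_le_ofReal_iff (by positivity),
      Real.exp_neg, mul_inv_le_iff₀ (Real.exp_pos _)] at h2
    exact h2
  · rw [Set.Infinite.ncard hf]
    push_cast
    positivity

/-! ### Embedding `W_ω(H)` in the wreath product over all rays -/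

/-- Extension by `1` of functions on an orbit. -/
noncomputable def extendOrbit {ω : Omega} {ξ : Ray} (f : restrictedPower (Orbit ω ξ) H) :
    restrictedPower Ray H :=
  ⟨Function.extend Subtype.val f.1 1, (Set.Finite.image Subtype.val f.2).subset fun ζ hζ => by
    by_cases h : ∃ q : Orbit ω ξ, q.1 = ζ
    · obtain ⟨q, rfl⟩ := h
      exact ⟨q, fun h => hζ ((Subtype.val_injective.extend_apply _ _ q).trans h), rfl⟩
    · exact absurd (Function.extend_apply' _ _ _ h) hζ⟩

theorem extendOrbit_val {ω : Omega} {ξ : Ray} (f : restrictedPower (Orbit ω ξ) H)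
    (q : Orbit ω ξ) : (extendOrbit f).1 q.1 = f.1 q :=
  Subtype.val_injective.extend_apply _ _ _

theorem extendOrbit_of_forall_ne {ω : Omega} {ξ : Ray} (f : restrictedPower (Orbit ω ξ) H)
    {ζ : Ray} (h : ¬∃ q : Orbit ω ξ, q.1 = ζ) : (extendOrbit f).1 ζ = 1 :=
  Function.extend_apply' _ _ _ h

theorem extendOrbit_injective {ω : Omega} {ξ : Ray} :
    Function.Injective (extendOrbit : restrictedPower (Orbit ω ξ) H → _) := fun f f' h => by
  refine Subtype.ext (funext fun q => ?_)
  rw [← extendOrbit_val, h, extendOrbit_val]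

/-- The embedding of `W_ω(H)` in the wreath product over all rays. -/
noncomputable def toFull (ω : Omega) (ξ : Ray) (H : Type*) [Group H] : W ω ξ H →* FullW ω H where
  toFun w := ⟨extendOrbit w.left, w.right⟩
  map_one' := by
    refine SemidirectProduct.ext (Subtype.ext (funext fun ζ => ?_)) rfl
    by_cases h : ∃ q : Orbit ω ξ, q.1 = ζ
    · obtain ⟨q, rfl⟩ := h; exact extendOrbit_val _ q
    · exact extendOrbit_of_forall_ne _ h
  map_mul' v w := by
    refine SemidirectProduct.ext (Subtype.ext (funext fun ζ => ?_)) rfl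
    rw [Wreath.mul_left_apply]
    by_cases h : ∃ q : Orbit ω ξ, q.1 = ζ
    · obtain ⟨q, rfl⟩ := h
      have h1 := extendOrbit_val w.left (Sym.app (orbitHom ω ξ v.right) q)
      change (extendOrbit w.left).1 (Sym.app (rayHom ω v.right) q.1) = _ at h1
      rw [extendOrbit_val, Wreath.mul_left_apply, h1, extendOrbit_val]
    · have h' : ¬∃ q : Orbit ω ξ, q.1 = Sym.app (rayHom ω v.right) ζ := by
        rintro ⟨q, hq⟩
        exact h ⟨⟨ζ, (orbit_invariant ω ξ v.right ζ).1 (by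
          obtain ⟨g, hg⟩ := q.2
          exact ⟨g, hg.trans hq⟩)⟩, rfl⟩
      rw [extendOrbit_of_forall_ne _ h, extendOrbit_of_forall_ne _ h,
        extendOrbit_of_forall_ne _ h', one_mul]

theorem toFull_injective (ω : Omega) (ξ : Ray) : Function.Injective (toFull ω ξ H) :=
  fun _ _ h => SemidirectProduct.ext
    (extendOrbit_injective (congrArg (fun u : FullW ω H => u.left) h))
    (congrArg (fun u : FullW ω H => u.right) h)

theorem exists_rep_toFull_of_mem_stdGens {ω : Omega} {ξ : Ray} {w : W ω ξ H}
    (hw : w ∈ stdGens ω ξ H) : ∃ L, 0 ≤ L ∧ Rep ω ξ L (toFull ω ξ H w) := by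
  have hinr : ∀ g : F, toFull ω ξ H (inr (mkG ω g)) = inr (mkG ω g) := fun g => by
    refine SemidirectProduct.ext ?_ rfl
    have h := congrArg (fun u : FullW ω H => u.left) (map_one (toFull ω ξ H))
    exact h
  rcases hw with ⟨x, rfl⟩ | ⟨h, rfl⟩
  · have hx : x = .a ∨ ∃ t, x = kernelLetter (ω 0 + t) := by
      have : x = .a ∨ ∃ t, x = kernelLetter t := by
        cases x
        exacts [Or.inl rfl, Or.inr ⟨0, rfl⟩, Or.inr ⟨1, rfl⟩, Or.inr ⟨2, rfl⟩]
      refine this.imp id ?_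
      rintro ⟨t, rfl⟩
      exact ⟨t - ω 0, by rw [add_sub_cancel]⟩
    rcases hx with rfl | ⟨t, rfl⟩
    · refine ⟨wtA, wtA_pos.le, ?_⟩
      have := (Rep.one (H := H) (ω := ω) (ξ := ξ)).aEl_mul
      rw [mul_one, add_zero] at this
      exact (hinr _).symm ▸ this
    · refine ⟨wt (some t), wt_nonneg _, ?_⟩
      have := Rep.base (SuppNear.one (H := H) ω ξ) (some t) le_rfl
      rw [kEl, map_one, one_mul] at this
      exact (hinr _).symm ▸ this
  · refine ⟨0, le_rfl, ?_⟩
    have hs : toFull ω ξ H (inl (single (basePoint ω ξ) h)) =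
        kEl ω (extendOrbit (single (basePoint ω ξ) h)) none :=
      ((congrArg _ (map_one inr)).trans (mul_one _)).symm
    rw [hs]
    refine Rep.base (fun ζ hζ => ?_) none le_rfl
    by_cases hq : ∃ q : Orbit ω ξ, q.1 = ζ
    · obtain ⟨q, rfl⟩ := hq
      rw [extendOrbit_val] at hζ
      have : q = basePoint ω ξ := by
        by_contra hne; exact hζ (single_of_ne hne h)
      subst this
      exact ⟨(false, none), by simp [vgen, move_one, basePoint]⟩
    · exact absurd (extendOrbit_of_forall_ne _ hq) hζ

theorem exists_rep_toFull {ω : Omega} {ξ : Ray} (w : W ω ξ H) :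
    ∃ L, 0 ≤ L ∧ Rep ω ξ L (toFull ω ξ H w) := by
  have hw : w ∈ Submonoid.closure (stdGens ω ξ H) := closure_stdGens (H := H) ω ξ ▸ trivial
  induction hw using Submonoid.closure_induction with
  | mem w hw => exact exists_rep_toFull_of_mem_stdGens hw
  | one => exact ⟨0, le_rfl, by rw [map_one]; exact Rep.one⟩
  | mul v w _ _ hv hw =>
    obtain ⟨L, hL, hv⟩ := hv
    obtain ⟨M, hM, hw⟩ := hw
    exact ⟨L + M, add_nonneg hL hM, by rw [map_mul]; exact hv.mul hw⟩

theorem exists_growth_le [Finite H] {ω : Omega} (hω : IsCyclic ω) {ξ : Ray} {S : Set (W ω ξ H)}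
    (hS : Submonoid.closure S = ⊤) (hf : S.Finite) :
    ∃ M : ℝ, 0 ≤ M ∧ ∀ (n : ℕ) (R : ℝ),
      growth S R ≤ growthBase H ^ 2 ^ n * Real.exp (ratio ^ n * convExp H * (M * R)) := by
  choose L hL0 hL using exists_rep_toFull (ω := ω) (ξ := ξ) (H := H)
  obtain ⟨M, hM⟩ := (hf.image L).bddAbove
  have hM' : ∀ s ∈ S, L s ≤ max M 0 := fun s hs =>
    (hM (Set.mem_image_of_mem L hs)).trans (le_max_left _ _)
  refine ⟨max M 0, le_max_right _ _, fun n R => ?_⟩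
  rw [growth, ← Set.ncard_image_of_injective _ (toFull_injective ω ξ)]
  refine ncard_le_of_rep hω (ξ := ξ) ?_ n
  rintro _ ⟨w, hw, rfl⟩
  obtain ⟨l, hl, hlS, rfl⟩ := exists_list_length_eq_wordNorm hS w
  have key : ∀ l : List (W ω ξ H), (∀ s ∈ l, s ∈ S) →
      Rep ω ξ (max M 0 * l.length) (toFull ω ξ H l.prod) := fun l hlS => by
    induction l with
    | nil => simpa using Rep.one
    | cons s l ih =>
      rw [List.prod_cons, map_mul]
      refine ((hL s).mul (ih fun t ht => hlS t (by simp [ht]))).mono ?_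
      have := hM' s (hlS s (by simp))
      rw [List.length_cons]
      push_cast
      linarith
  refine (key l hlS).mono (mul_le_mul_of_nonneg_left ?_ (le_max_right _ _))
  rw [hl]
  exact hw

/-! ### The growth exponent -/

/-- The growth exponent `log 2 / log η₊`. -/
noncomputable def expo : ℝ := Real.log 2 / Real.log etaPlus

theorem one_lt_etaPlus : 1 < etaPlus := one_lt_two.trans etaPlus_gt_two

theorem expo_pos : 0 < expo := div_pos (Real.log_pos one_lt_two) (Real.log_pos one_lt_etaPlus)

theorem etaPlus_pow_rpow_expo (n : ℕ) : (etaPlus ^ n) ^ expo = 2 ^ n := by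
  have h : etaPlus ^ expo = 2 := by
    rw [Real.rpow_def_of_pos etaPlus_pos, expo,
      mul_div_cancel₀ _ (Real.log_pos one_lt_etaPlus).ne', Real.exp_log two_pos]
  rw [← Real.rpow_natCast, ← Real.rpow_mul etaPlus_pos.le, mul_comm, Real.rpow_mul etaPlus_pos.le,
    h, Real.rpow_natCast]

theorem growth_mono {Γ : Type*} [Group Γ] {S : Set Γ} (hS : Submonoid.closure S = ⊤)
    (hf : S.Finite) : Monotone (growth S) := fun _ R h =>
  Nat.cast_le.2 (Set.ncard_le_ncard (fun _ hg => le_trans hg h) (finite_setOf_wordNorm_le hS hf R))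

theorem growth_dominated [Finite H] {ω : Omega} (hω : IsCyclic ω) {ξ : Ray} {S : Set (W ω ξ H)}
    (hS : Submonoid.closure S = ⊤) (hf : S.Finite) :
    Dominated (growth S) fun R => Real.exp (R ^ expo) := by
  obtain ⟨M, hM0, hM⟩ := exists_growth_le hω hS hf
  have hB : 1 ≤ growthBase H := by
    have h1 : (1 : ℝ) ≤ kCard H := by exact_mod_cast one_le_kCard H
    have h2 := Real.one_le_exp (mul_nonneg (convExp_nonneg H) wtA_pos.le)
    unfold growthBase
    nlinarith
  set E := Real.log (growthBase H) + convExp H * M * etaPlus with hE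
  have hE1 : 0 < max E 1 := lt_max_of_lt_right one_pos
  refine ⟨max E 1 ^ expo⁻¹, Real.rpow_pos_of_pos hE1 _, ?_⟩
  filter_upwards [Filter.eventually_ge_atTop 1] with R hR
  obtain ⟨n, hn, hn'⟩ := exists_nat_pow_near hR one_lt_etaPlus
  have hR0 : 0 ≤ R := zero_le_one.trans hR
  refine (hM n R).trans ?_
  rw [← Real.exp_log (pow_pos (zero_lt_one.trans_le hB) (2 ^ n)), ← Real.exp_add, Real.exp_le_exp,
    Real.log_pow, Real.mul_rpow (Real.rpow_nonneg hE1.le _) hR0, ← Real.rpow_mul hE1.le,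
    inv_mul_cancel₀ expo_pos.ne', Real.rpow_one]
  have h1 : (2 : ℝ) ^ n ≤ R ^ expo := by
    rw [← etaPlus_pow_rpow_expo]
    exact Real.rpow_le_rpow (pow_nonneg etaPlus_pos.le _) hn expo_pos.le
  have h2 : ratio ^ n * R ≤ 2 ^ n * etaPlus := by
    calc ratio ^ n * R ≤ ratio ^ n * etaPlus ^ (n + 1) :=
          mul_le_mul_of_nonneg_left hn'.le (pow_nonneg ratio_pos.le _)
      _ = _ := by rw [pow_succ, ← mul_assoc, ← mul_pow, ratio_mul_etaPlus]
  have h3 := mul_le_mul_of_nonneg_left h2 (mul_nonneg (convExp_nonneg H) hM0)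
  calc _ ≤ E * 2 ^ n := by push_cast; rw [hE]; linarith
    _ ≤ max E 1 * 2 ^ n := by gcongr; exact le_max_left _ _
    _ ≤ _ := mul_le_mul_of_nonneg_left h1 hE1.le

theorem dominated_growth [Finite H] [Nontrivial H] {ω : Omega} (hω : IsCyclic ω) {ξ : Ray}
    {S : Set (W ω ξ H)} (hS : Submonoid.closure S = ⊤) (hf : S.Finite) :
    Dominated (fun R => Real.exp (R ^ expo)) (growth S) := by
  obtain ⟨M, hM⟩ := ((stdGens_finite (H := H) ω ξ).image (wordNorm S)).bddAbove
  have hM' : ∀ s ∈ stdGens ω ξ H, wordNorm S s ≤ M + 1 := fun s hs =>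
    (hM (Set.mem_image_of_mem _ hs)).trans (Nat.le_succ M)
  have hr := ratio_pos
  have he := etaPlus_pos
  set B : ℝ := 3 * (2 / ratio ^ 2) * (M + 1 : ℕ)
  have hB : 0 < B := by positivity
  refine ⟨B * etaPlus ^ 2, by positivity, ?_⟩
  filter_upwards [Filter.eventually_ge_atTop 1] with R hR
  obtain ⟨n, hn, hn'⟩ := exists_nat_pow_near hR one_lt_etaPlus
  have h1 : R ^ expo ≤ 2 ^ (n + 1) := by
    rw [← etaPlus_pow_rpow_expo]
    exact Real.rpow_le_rpow (zero_le_one.trans hR) hn'.le expo_pos.le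
  calc Real.exp (R ^ expo) ≤ Real.exp (Real.log 2 * 2 ^ (n + 2)) := by
        refine Real.exp_le_exp.2 (h1.trans ?_)
        have := Real.log_two_gt_d9
        rw [pow_succ _ (n + 1)]
        nlinarith [pow_pos (two_pos (α := ℝ)) (n + 1)]
    _ = 2 ^ 2 ^ (n + 2) := by
        rw [mul_comm, ← Real.exp_log (pow_pos (two_pos (α := ℝ)) (2 ^ (n + 2))), Real.log_pow]
        push_cast; rfl
    _ ≤ growth S (3 * (zetaIter (n + 2)).length * (M + 1 : ℕ)) :=
        two_pow_le_growth hω ξ hS hf hM' (n + 2)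
    _ ≤ growth S (B * etaPlus ^ 2 * R) := by
        refine growth_mono hS hf ?_
        calc (3 * (zetaIter (n + 2)).length * (M + 1 : ℕ) : ℝ)
            ≤ 3 * (2 / ratio ^ 2 * etaPlus ^ (n + 2)) * (M + 1 : ℕ) := by
              gcongr; exact length_zetaIter_le _
          _ = B * etaPlus ^ 2 * etaPlus ^ n := by ring
          _ ≤ _ := by gcongr

theorem fg_W [Finite H] (ω : Omega) (ξ : Ray) : Group.FG (W ω ξ H) := by
  rw [Group.fg_iff_monoid_fg]
  exact ⟨(Submonoid.fg_iff _).2 ⟨_, closure_stdGens ω ξ, stdGens_finite ω ξ⟩⟩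

end GrigorchukWreath

theorem mainTheorem4 (H : Type*) [Group H] [Finite H] [Nontrivial H] (ξ : GrigorchukWreath.Ray) :
    Group.FG (GrigorchukWreath.W GrigorchukWreath.omega012 ξ H) ∧
      ∀ S : Set (GrigorchukWreath.W GrigorchukWreath.omega012 ξ H),
        S.Finite → Submonoid.closure S = ⊤ →
          GrigorchukWreath.GrowthEquiv (GrigorchukWreath.growth S)
            (fun R => Real.exp (R ^ (Real.log 2 / Real.log GrigorchukWreath.etaPlus))) :=
  ⟨GrigorchukWreath.fg_W _ ξ, fun _ hf hS =>
    ⟨GrigorchukWreath.growth_dominated GrigorchukWreath.isCyclic_omega012 hS hf,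
      GrigorchukWreath.dominated_growth GrigorchukWreath.isCyclic_omega012 hS hf⟩⟩
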